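/- Let $\ell\ge 3$. An $\ell$-uniform hypergraph $G$ is \emph{disperse} if every set of $\ell+1$ vertices contains exactly $0$, $1$, $\ell$ or $\ell+1$ edges of $G$. Let $\alpha(G)$ and $\omega(G)$ denote the maximum size of an independent set (a vertex set containing no edge) and of a clique (a vertex set all of whose $\ell$-subsets are edges). An $\ell$-uniform hypergraph $G$ is a \emph{cohypergraph} if either $|V(G)|=1$, or there is a partition $V(G)=X\cup Y$ into nonempty sets such that the induced hypergraphs $G[X]$ and $G[Y]$ are cohypergraphs and $E(G)$ contains all or none of the $\ell$-sets which intersect both $X$ and $Y$. \begin{enumerate} \item There is an absolute constant $c>0$ such that for every $\ell\ge 3$, every disperse $\ell$-uniform hypergraph $G$ on $n$ vertices satisfies $$\max(\alpha(G),\omega(G))\ \ge\ c\, n^{\frac{1}{3\ell-1}} .$$ \item For every $\ell\ge 3$ there is a constant $C=C(\ell)>0$ such that every disperse $\ell$-uniform hypergraph on $n\ge 1$ vertices can be turned into a cohypergraph on the same vertex set by adding and deleting at most $C\,n^{\ell-\frac12}$ edges; in particular, by changing $o(n^{\ell})$ edges as $n\to\infty$ with $\ell$ fixed. \end{enumerate}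 -/

import Mathlib

open Finset
open scoped symmDiff

/-- An `ℓ`-uniform hypergraph with vertex set (all of) `V`. -/
structure UniformHypergraph (V : Type*) (ℓ : ℕ) where
  /-- The set of edges. -/
  edges : Finset (Finset V)
  /-- Every edge has exactly `ℓ` vertices. -/
  card_of_mem : ∀ e ∈ edges, #e = ℓ

namespace UniformHypergraph

variable {V : Type*} {ℓ : ℕ}

/-- The number `e_G(X)` of edges of `G` contained in the vertex set `X`. -/
def edgesIn [DecidableEq V] (G : UniformHypergraph V ℓ) (X : Finset V) : ℕ :=
  #{e ∈ G.edges | e ⊆ X}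

/-- `G` is disperse if every set of `ℓ + 1` vertices spans `0`, `1`, `ℓ` or `ℓ + 1` edges. -/
def IsDisperse [DecidableEq V] (G : UniformHypergraph V ℓ) : Prop :=
  ∀ X : Finset V, #X = ℓ + 1 →
    G.edgesIn X = 0 ∨ G.edgesIn X = 1 ∨ G.edgesIn X = ℓ ∨ G.edgesIn X = ℓ + 1

/-- `S` is a clique: every `ℓ`-subset of `S` is an edge. -/
def IsClique (G : UniformHypergraph V ℓ) (S : Finset V) : Prop :=
  ∀ e ⊆ S, #e = ℓ → e ∈ G.edges

/-- `S` is independent: no edge is contained in `S`. -/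
def IsIndependent (G : UniformHypergraph V ℓ) (S : Finset V) : Prop :=
  ∀ e ⊆ S, e ∉ G.edges

open Classical in
/-- The clique number `ω(G)`: the maximum size of a clique. -/
noncomputable def cliqueNumber [Fintype V] (G : UniformHypergraph V ℓ) : ℕ :=
  ({S : Finset V | G.IsClique S} : Finset (Finset V)).sup card

open Classical in
/-- The independence number `α(G)`: the maximum size of an independent set. -/
noncomputable def independenceNumber [Fintype V] (G : UniformHypergraph V ℓ) : ℕ :=
  ({S : Finset V | G.IsIndependent S} : Finset (Finset V)).sup card

/-- `G.IsCohypergraphOn W` says that the induced hypergraph `G[W]` is a cohypergraph: either `W`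
is a single vertex, or `W` is partitioned into nonempty sets `X` and `Y` such that `G[X]` and
`G[Y]` are cohypergraphs and `G` contains all or none of the `ℓ`-subsets of `W` which intersect
both `X` and `Y`. -/
inductive IsCohypergraphOn [DecidableEq V] (G : UniformHypergraph V ℓ) : Finset V → Prop
  | single (v : V) : IsCohypergraphOn G {v}
  | join (X Y : Finset V) (hX : X.Nonempty) (hY : Y.Nonempty) (hXY : Disjoint X Y)
      (hGX : IsCohypergraphOn G X) (hGY : IsCohypergraphOn G Y)
      (h : (∀ e ⊆ X ∪ Y, #e = ℓ → (e ∩ X).Nonempty → (e ∩ Y).Nonempty → e ∈ G.edges) ∨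
        (∀ e ⊆ X ∪ Y, #e = ℓ → (e ∩ X).Nonempty → (e ∩ Y).Nonempty → e ∉ G.edges)) :
      IsCohypergraphOn G (X ∪ Y)

/-- `G` is a cohypergraph. -/
def IsCohypergraph [Fintype V] [DecidableEq V] (G : UniformHypergraph V ℓ) : Prop :=
  G.IsCohypergraphOn univ

end UniformHypergraph

/-! The dispersity condition forces a hypergraph to decompose along cuts that are almost empty or
almost complete, and this recursion assembles an approximating cohypergraph.

The link of an `(ℓ - 2)`-set `S` is a graph without induced four-vertex paths
(`DispersePred.pathFourFree`), so by Seinsche's theorem it or its complement is disconnected.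
Complementation preserves the hypothesis, so suppose the link is disconnected, and let `A` be the
component of a non-isolated vertex. Again by Seinsche, `A` is a join of two parts. This join
structure rules out every edge with `ℓ - 1` vertices in `A` and one vertex outside `A ∪ S`
(`DispersePred.not_edge_of_component`). A doubling induction then bounds the extensions of each `(ℓ
- 1)`-set meeting the outside, so few edges cross between `A ∪ S` and the rest
(`DispersePred.card_crossing_le`). If some `(ℓ - 1)`-set containing `S` has degree at least `m`,
then `A ∪ S` has size at least `m`. Hence a large vertex set has such a cut, for `E` or its
complement, or else all its `(ℓ - 1)`-sets have small degree, or all have small codegree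
(`DispersePred.uniform_or_hasSparseCut`).

Cutting repeatedly gives a cohypergraph that is wrong on at most about `n ^ ℓ / m` crossing sets, up
to a factor depending on `ℓ`, plus errors inside the final pieces. For the edit distance, the pieces
are made complete or empty and `m` is about `√n`. For the Erdős–Hajnal bound, a piece of small
degree or codegree contains a large independent set or clique, so if both numbers are small then all
pieces are small. A random vertex set, after deletions, avoids all crossing errors and all pairs
inside a piece. On it the hypergraph agrees with a cohypergraph, where the product of the clique and
independence numbers is at least the number of vertices. -/

/-! ### Links of `(ℓ - 2)`-sets and cographs. -/

section Structure

variable {V : Type*}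

/-- No `ℓ + 1` vertices contain both two `ℓ`-sets satisfying `E` and two `ℓ`-sets violating it. -/
def DispersePred (E : Finset V → Prop) (ℓ : ℕ) : Prop :=
  ∀ X : Finset V, #X = ℓ + 1 → ∀ e₁ e₂ f₁ f₂ : Finset V, e₁ ⊆ X → e₂ ⊆ X → f₁ ⊆ X → f₂ ⊆ X →
    #e₁ = ℓ → #e₂ = ℓ → #f₁ = ℓ → #f₂ = ℓ → e₁ ≠ e₂ → f₁ ≠ f₂ →
    E e₁ → E e₂ → ¬ E f₁ → ¬ E f₂ → False

theorem DispersePred.compl {E : Finset V → Prop} {ℓ : ℕ} (h : DispersePred E ℓ) :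
    DispersePred (fun e => ¬ E e) ℓ := by
  intro X hX e₁ e₂ f₁ f₂ h1 h2 h3 h4 c1 c2 c3 c4 n1 n2 a b c d
  exact h X hX f₁ f₂ e₁ e₂ h3 h4 h1 h2 c3 c4 c1 c2 n2 n1 (not_not.1 c) (not_not.1 d) a b

/-- `g` has no induced path on four vertices. -/
def PathFourFree (g : V → V → Prop) (W : Finset V) : Prop :=
  ∀ a ∈ W, ∀ b ∈ W, ∀ c ∈ W, ∀ d ∈ W, a ≠ b → a ≠ c → a ≠ d → b ≠ c → b ≠ d → c ≠ d →
    g a b → g b c → g c d → ¬ g a c → ¬ g a d → ¬ g b d → False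

theorem PathFourFree.mono {g : V → V → Prop} {W W' : Finset V} (h : PathFourFree g W)
    (hW : W' ⊆ W) : PathFourFree g W' :=
  fun a ha b hb c hc d hd => h a (hW ha) b (hW hb) c (hW hc) d (hW hd)

theorem PathFourFree.compl {g : V → V → Prop} (hg : ∀ x y, g x y → g y x) {W : Finset V}
    (h : PathFourFree g W) : PathFourFree (fun x y => ¬ g x y) W := by
  intro a ha b hb c hc d hd hab hac had hbc hbd hcd e1 e2 e3 n1 n2 n3
  rw [not_not] at n1 n2 n3
  exact h b hb d hd a ha c hc hbd hab.symm hbc had.symm hcd.symm hac n3 (hg _ _ n2) n1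
    (fun k => e1 (hg _ _ k)) e2 (fun k => e3 (hg _ _ k))

variable [DecidableEq V]

/-- Modulo `T` this is the case of triples: four vertices span four triples, and two present with
two absent is forbidden. -/
theorem DispersePred.pathFourFree_aux {E : Finset V → Prop} {ℓ : ℕ} (h : DispersePred E ℓ)
    {T : Finset V} (hT : #T + 3 = ℓ) {x y z w : V} (hxy : x ≠ y) (hxz : x ≠ z) (hxw : x ≠ w)
    (hyz : y ≠ z) (hyw : y ≠ w) (hzw : z ≠ w) (hx : x ∉ T) (hy : y ∉ T) (hz : z ∉ T) (hw : w ∉ T)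
    (p : E (insert x (insert y (insert z T)))) (q : E (insert y (insert z (insert w T))))
    (r : ¬ E (insert x (insert y (insert w T)))) (s : ¬ E (insert x (insert z (insert w T)))) :
    False := by
  have card3 : ∀ x y z : V, x ≠ y → x ≠ z → y ≠ z → x ∉ T → y ∉ T → z ∉ T →
      #(insert x (insert y (insert z T))) = ℓ := by
    intro x y z h1 h2 h3 h4 h5 h6
    rw [card_insert_of_notMem (by simp [*]), card_insert_of_notMem (by simp [*]),
      card_insert_of_notMem h6]
    omega
  have hX : #(insert x (insert y (insert z (insert w T)))) = ℓ + 1 := by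
    rw [card_insert_of_notMem (by simp [*]), card3 y z w hyz hyw hzw hy hz hw]
  refine h _ hX _ _ _ _ ?_ ?_ ?_ ?_
    (card3 x y z hxy hxz hyz hx hy hz) (card3 y z w hyz hyw hzw hy hz hw)
    (card3 x y w hxy hxw hyw hx hy hw) (card3 x z w hxz hxw hzw hx hz hw) ?_ ?_ p q r s
  iterate 4
    intro k hk
    simp only [mem_insert] at hk ⊢
    tauto
  · intro hh
    have : x ∈ insert y (insert z (insert w T)) := hh ▸ mem_insert_self _ _
    simp only [mem_insert] at this
    tauto
  · intro hh
    have : y ∈ insert x (insert z (insert w T)) := hh ▸ by simp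
    simp only [mem_insert] at this
    tauto

/-- Links of `(ℓ - 2)`-sets are cographs. -/
theorem DispersePred.pathFourFree {E : Finset V → Prop} {ℓ : ℕ} (h : DispersePred E ℓ)
    (hℓ : 3 ≤ ℓ) {S : Finset V} (hS : #S = ℓ - 2) (W : Finset V) (hW : Disjoint W S) :
    PathFourFree (fun x y => E (insert x (insert y S))) W := by
  intro a ha b hb c hc d hd hab hac had hbc hbd hcd e1 e2 e3 n1 n2 n3
  have ha' := disjoint_left.1 hW ha
  have hb' := disjoint_left.1 hW hb
  have hc' := disjoint_left.1 hW hc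
  have hd' := disjoint_left.1 hW hd
  obtain ⟨v, T, hvT, rfl, hT⟩ := (card_eq_succ (s := S) (n := ℓ - 3)).1 (by omega)
  replace hT : #T + 3 = ℓ := by omega
  simp only [mem_insert, not_or] at ha' hb' hc' hd'
  obtain ⟨hav, haT⟩ := ha'
  obtain ⟨hbv, hbT⟩ := hb'
  obtain ⟨hcv, hcT⟩ := hc'
  obtain ⟨hdv, hdT⟩ := hd'
  have perm1 : ∀ x y : V, insert x (insert y (insert v T)) = insert x (insert v (insert y T)) := by
    intro x y; rw [insert_comm y v]
  have perm2 : ∀ x y : V, insert x (insert y (insert v T)) = insert v (insert x (insert y T)) := by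
    intro x y; rw [perm1, insert_comm]
  -- Modulo `T`, on `v` and three path vertices the three triples through `v` are known, and the
  -- majority decides the fourth: `abc` and `bcd` are present, `abd` and `acd` are absent. Then `a,
  -- b, c, d` span two of each.
  have k1 : E (insert a (insert b (insert c T))) := by
    by_contra hn
    exact h.pathFourFree_aux hT hab hav hac hbv hbc (Ne.symm hcv) haT hbT hvT hcT e1
      (perm1 b c ▸ e2) hn (perm1 a c ▸ n1)
  have k2 : E (insert b (insert c (insert d T))) := by
    by_contra hn
    exact h.pathFourFree_aux hT hbc hbv hbd hcv hcd (Ne.symm hdv) hbT hcT hvT hdT e2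
      (perm1 c d ▸ e3) hn (perm1 b d ▸ n3)
  have k3 : ¬ E (insert a (insert b (insert d T))) := by
    intro hn
    exact h.pathFourFree_aux hT (Ne.symm hav) (Ne.symm hbv) (Ne.symm hdv) hab had hbd hvT haT hbT
      hdT (perm2 a b ▸ e1) hn (perm2 a d ▸ n2) (perm2 b d ▸ n3)
  have k4 : ¬ E (insert a (insert c (insert d T))) := by
    intro hn
    have e3' : E (insert v (insert d (insert c T))) := by
      rw [insert_comm d c, ← perm2]; exact e3
    have hn' : E (insert d (insert c (insert a T))) := by
      rw [insert_comm c a, insert_comm d a, insert_comm d c]; exact hn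
    have n2' : ¬ E (insert v (insert d (insert a T))) := by
      rw [insert_comm d a, ← perm2]; exact n2
    have n1' : ¬ E (insert v (insert c (insert a T))) := by
      rw [insert_comm c a, ← perm2]; exact n1
    exact h.pathFourFree_aux hT (Ne.symm hdv) (Ne.symm hcv) (Ne.symm hav) (Ne.symm hcd)
      (Ne.symm had) (Ne.symm hac) hvT hdT hcT haT e3' hn' n2' n1'
  exact h.pathFourFree_aux hT hab hac had hbc hbd hcd haT hbT hcT hdT k1 k2 k3 k4

/-- One step of the induction in Seinsche's theorem. -/
theorem PathFourFree.extend_split {g : V → V → Prop} (hg : ∀ x y, g x y → g y x) {v : V}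
    {W X Y : Finset V} (hv : v ∉ W) (h : PathFourFree g (insert v W)) (hX : X.Nonempty)
    (hY : Y.Nonempty) (hXY : Disjoint X Y) (hW : X ∪ Y = W) (hno : ∀ x ∈ X, ∀ y ∈ Y, ¬ g x y) :
    ∃ X' Y' : Finset V, X'.Nonempty ∧ Y'.Nonempty ∧ Disjoint X' Y' ∧ X' ∪ Y' = insert v W ∧
      ((∀ x ∈ X', ∀ y ∈ Y', g x y) ∨ (∀ x ∈ X', ∀ y ∈ Y', ¬ g x y)) := by
  classical
  subst hW
  by_cases hX0 : ∀ x ∈ X, ¬ g x v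
  · refine ⟨X, insert v Y, hX, insert_nonempty _ _, by grind, by grind, Or.inr ?_⟩
    intro x hx y hy
    rcases mem_insert.1 hy with rfl | hy
    · exact hX0 x hx
    · exact hno x hx y hy
  by_cases hY0 : ∀ y ∈ Y, ¬ g y v
  · refine ⟨Y, insert v X, hY, insert_nonempty _ _, by grind, by grind, Or.inr ?_⟩
    intro y hy x hx
    rcases mem_insert.1 hx with rfl | hx
    · exact hY0 y hy
    · exact fun k => hno x hx y hy (hg _ _ k)
  push Not at hX0 hY0
  obtain ⟨x₀, hx₀, hx₀v⟩ := hX0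
  obtain ⟨y₀, hy₀, hy₀v⟩ := hY0
  by_cases hall : ∀ z ∈ X ∪ Y, g v z
  · refine ⟨{v}, X ∪ Y, by simp, ⟨x₀, by simp [hx₀]⟩, by simpa using hv, by grind, Or.inl ?_⟩
    simpa using hall
  push Not at hall
  obtain ⟨z₀, hz₀, hz₀v⟩ := hall
  -- An edge from a neighbour `x` of `v` to a non-neighbour `y` in the same part would complete an
  -- induced path: a neighbour of `v` in the other part, then `v`, `x`, `y`.
  have hstep : ∀ x y : V, g v x → ¬ g v y → ((x ∈ X ∧ y ∈ X) ∨ (x ∈ Y ∧ y ∈ Y)) → ¬ g x y := by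
    intro x y hx hy hxy hgxy
    rcases hxy with ⟨hxX, hyX⟩ | ⟨hxY, hyY⟩
    · refine h y₀ (by grind) v (by grind) x (by grind) y (by grind) ?_ ?_ ?_ ?_ ?_ ?_ hy₀v hx hgxy
        (fun k => hno x hxX y₀ hy₀ (hg _ _ k)) (fun k => hno y hyX y₀ hy₀ (hg _ _ k)) hy
      all_goals grind [disjoint_left]
    · refine h x₀ (by grind) v (by grind) x (by grind) y (by grind) ?_ ?_ ?_ ?_ ?_ ?_ hx₀v hx hgxy
        (fun k => hno x₀ hx₀ x hxY k) (fun k => hno x₀ hx₀ y hyY k) hy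
      all_goals grind [disjoint_left]
  refine ⟨insert v {x ∈ X ∪ Y | g v x}, {x ∈ X ∪ Y | ¬ g v x}, insert_nonempty _ _,
    ⟨z₀, by simp_all⟩, by grind [disjoint_left], by grind, Or.inr ?_⟩
  intro x hx y hy
  simp only [mem_filter, mem_union, mem_insert] at hx hy
  rcases hx with rfl | ⟨hxm, hxv⟩
  · exact hy.2
  · rcases hxm with hxX | hxY <;> rcases hy.1 with hyX | hyY
    · exact hstep x y hxv hy.2 (Or.inl ⟨hxX, hyX⟩)
    · exact hno x hxX y hyY
    · exact fun k => hno y hyX x hxY (hg _ _ k)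
    · exact hstep x y hxv hy.2 (Or.inr ⟨hxY, hyY⟩)

/-- Seinsche's theorem: a graph on at least two vertices without an induced path on four
vertices, or its complement, is disconnected. -/
theorem PathFourFree.exists_split {g : V → V → Prop} (hg : ∀ x y, g x y → g y x)
    (W : Finset V) (h : PathFourFree g W) (hW : 2 ≤ #W) :
    ∃ X Y : Finset V, X.Nonempty ∧ Y.Nonempty ∧ Disjoint X Y ∧ X ∪ Y = W ∧
      ((∀ x ∈ X, ∀ y ∈ Y, g x y) ∨ (∀ x ∈ X, ∀ y ∈ Y, ¬ g x y)) := by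
  induction W using Finset.induction_on with
  | empty => simp at hW
  | insert v W hv ih =>
    rw [card_insert_of_notMem hv] at hW
    rcases (show #W = 1 ∨ 2 ≤ #W by omega) with h1 | h2
    · obtain ⟨w, rfl⟩ := card_eq_one.1 h1
      refine ⟨{v}, {w}, by simp, by simp, by simpa [eq_comm] using hv, rfl, ?_⟩
      simp [em]
    · obtain ⟨X, Y, hX, hY, hXY, hU, hh⟩ := ih (h.mono (subset_insert _ _)) h2
      rcases hh with hall | hno
      · obtain ⟨X', Y', a, b, c, d, e⟩ := (h.compl hg).extend_split
          (fun x y k k' => k (hg _ _ k')) hv hX hY hXY hU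
          (fun x hx y hy => not_not.2 (hall x hx y hy))
        refine ⟨X', Y', a, b, c, d, ?_⟩
        rcases e with e | e
        · exact Or.inr e
        · exact Or.inl fun x hx y hy => not_not.1 (e x hx y hy)
      · exact h.extend_split hg hv hX hY hXY hU hno

/-- In a disconnected cograph, the component of a non-isolated vertex is a join of two parts. -/
theorem PathFourFree.exists_component {g : V → V → Prop} (hg : ∀ x y, g x y → g y x)
    {W X Y : Finset V} (h : PathFourFree g W) (hX : X.Nonempty) (hY : Y.Nonempty)
    (hXY : Disjoint X Y) (hU : X ∪ Y = W) (hno : ∀ x ∈ X, ∀ y ∈ Y, ¬ g x y)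
    {w z : V} (hw : w ∈ W) (hz : z ∈ W) (hzw : z ≠ w) (hwz : g w z) :
    ∃ A₁ A₂ : Finset V, A₁.Nonempty ∧ A₂.Nonempty ∧ Disjoint A₁ A₂ ∧ A₁ ∪ A₂ ⊂ W ∧
      (∀ x ∈ A₁, ∀ y ∈ A₂, g x y) ∧ (∀ x ∈ A₁ ∪ A₂, ∀ y ∈ W \ (A₁ ∪ A₂), ¬ g x y) ∧
      w ∈ A₁ ∪ A₂ ∧ ∀ y ∈ W, g w y → y ∈ A₁ ∪ A₂ := by
  classical
  set 𝒜 : Finset (Finset V) := {A ∈ W.powerset | A ≠ W ∧ w ∈ A ∧ ∀ x ∈ A, ∀ y ∈ W \ A, ¬ g x y}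
    with h𝒜
  have hne : 𝒜.Nonempty := by
    subst hU
    rcases mem_union.1 hw with hw | hw
    · obtain ⟨y, hy⟩ := hY
      refine ⟨X, ?_⟩
      simp only [h𝒜, mem_filter, mem_powerset]
      refine ⟨subset_union_left, ?_, hw, ?_⟩
      · intro hh
        have : y ∈ X := by rw [hh]; simp [hy]
        exact disjoint_left.1 hXY this hy
      · intro x hx y hy; exact hno x hx y (by grind)
    · obtain ⟨x, hx⟩ := hX
      refine ⟨Y, ?_⟩
      simp only [h𝒜, mem_filter, mem_powerset]
      refine ⟨subset_union_right, ?_, hw, ?_⟩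
      · intro hh
        have : x ∈ Y := by rw [hh]; simp [hx]
        exact disjoint_left.1 hXY hx this
      · intro x hx y hy k; exact hno y (by grind) x hx (hg _ _ k)
  obtain ⟨A, hA, hmin⟩ := exists_min_image 𝒜 card hne
  simp only [h𝒜, mem_filter, mem_powerset] at hA hmin
  obtain ⟨hAW, hAne, hwA, hclosed⟩ := hA
  have hnb : ∀ y ∈ W, g w y → y ∈ A := by
    intro y hy hwy
    by_contra hyA
    exact hclosed w hwA y (by simp [hy, hyA]) hwy
  have hcard : 2 ≤ #A := by
    have : ({z, w} : Finset V) ⊆ A := by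
      intro x hx
      simp only [mem_insert, mem_singleton] at hx
      rcases hx with rfl | rfl
      · exact hnb _ hz hwz
      · exact hwA
    have := card_le_card this
    rwa [card_pair hzw] at this
  obtain ⟨A₁, A₂, hA1, hA2, hd, rfl, hh⟩ := (h.mono hAW).exists_split hg A hcard
  refine ⟨A₁, A₂, hA1, hA2, hd, hAW.ssubset_of_ne hAne, ?_, hclosed, hwA, hnb⟩
  rcases hh with hh | hh
  · exact hh
  · exfalso
    -- In a disconnected splitting of `A`, the side containing `w` would be a smaller closed set,
    -- against the minimality of `A`.
    have aux : ∀ B C : Finset V, B ∪ C = A₁ ∪ A₂ → Disjoint B C → C.Nonempty →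
        (∀ x ∈ B, ∀ y ∈ C, ¬ g x y) → w ∈ B → False := by
      intro B C hBC hdis hC hn hwB
      have hlt : #B < #(A₁ ∪ A₂) := by
        rw [← hBC, card_union_of_disjoint hdis]
        have := hC.card_pos
        omega
      refine absurd (hmin B ⟨?_, ?_, hwB, ?_⟩) (by omega)
      · exact (hBC ▸ subset_union_left).trans hAW
      · rintro rfl
        have := card_le_card hAW
        omega
      · intro x hx y hy
        by_cases hyC : y ∈ C
        · exact hn x hx y hyC
        · have hyn : y ∉ A₁ ∪ A₂ := by rw [← hBC]; grind
          exact hclosed x (hBC ▸ mem_union_left _ hx) y (by grind)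
    rcases mem_union.1 hwA with h1 | h2
    · exact aux A₁ A₂ rfl hd hA2 hh h1
    · exact aux A₂ A₁ (union_comm _ _) hd.symm hA1 (fun x hx y hy k => hh y hy x hx (hg _ _ k)) h2

end Structure

/-! ### Edges forced and forbidden by a joined component of a link. -/

section Structure

variable {V : Type*} [DecidableEq V]

theorem DispersePred.erase {E : Finset V → Prop} {ℓ : ℕ} (h : DispersePred E ℓ) {X : Finset V}
    (hX : #X = ℓ + 1) {x y z w : V} (hx : x ∈ X) (hy : y ∈ X) (hz : z ∈ X) (hw : w ∈ X)
    (hxy : x ≠ y) (hzw : z ≠ w) (ex : E (X.erase x)) (ey : E (X.erase y))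
    (ez : ¬ E (X.erase z)) (ew : ¬ E (X.erase w)) : False := by
  have hc : ∀ v ∈ X, #(X.erase v) = ℓ := fun v hv => by rw [card_erase_of_mem hv, hX]; rfl
  have hne : ∀ u v : V, u ∈ X → u ≠ v → X.erase u ≠ X.erase v := by
    intro u v hu huv he
    exact notMem_erase u X (he ▸ mem_erase.2 ⟨huv, hu⟩)
  exact h X hX _ _ _ _ (erase_subset _ _) (erase_subset _ _) (erase_subset _ _) (erase_subset _ _)
    (hc x hx) (hc y hy) (hc z hz) (hc w hw) (hne x y hx hxy) (hne z w hz hzw) ex ey ez ew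

theorem erase_union_of_notMem_right {A B : Finset V} {v : V} (hv : v ∉ B) :
    (A ∪ B).erase v = A.erase v ∪ B := by
  rw [erase_union_distrib, erase_eq_of_notMem hv]

theorem erase_union_of_notMem_left {A B : Finset V} {v : V} (hv : v ∉ A) :
    (A ∪ B).erase v = A ∪ B.erase v := by
  rw [erase_union_distrib, erase_eq_of_notMem hv]

/-- One of the two intersections has at least two elements and survives any deletion. Only an
element of the other intersection can be critical, so it suffices to protect one such element. -/
theorem exists_forall_erase_inter_nonempty {A₁ A₂ T : Finset V} (hA : Disjoint A₁ A₂)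
    (hT : T ⊆ A₁ ∪ A₂) (h3 : 3 ≤ #T) (h1 : (T ∩ A₁).Nonempty) (h2 : (T ∩ A₂).Nonempty) :
    ∃ t₀, ∀ t ∈ T, t ≠ t₀ → (T.erase t ∩ A₁).Nonempty ∧ (T.erase t ∩ A₂).Nonempty := by
  have aux : ∀ t, ∀ B : Finset V, 2 ≤ #(T ∩ B) → (T.erase t ∩ B).Nonempty := by
    intro t B hB
    rw [erase_inter, ← card_pos]
    have := pred_card_le_card_erase (s := T ∩ B) (a := t)
    omega
  have hsum : #(T ∩ A₁) + #(T ∩ A₂) = #T := by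
    rw [← card_union_of_disjoint (hA.mono inter_subset_right inter_subset_right),
      ← inter_union_distrib_left, inter_eq_left.2 hT]
  have hp1 := h1.card_pos
  have hp2 := h2.card_pos
  obtain ⟨x, hx⟩ := h1
  obtain ⟨y, hy⟩ := h2
  by_cases hc1 : 2 ≤ #(T ∩ A₁)
  · refine ⟨y, fun t _ hty => ⟨aux t A₁ hc1, y, ?_⟩⟩
    simp only [mem_inter, mem_erase] at hy ⊢
    exact ⟨⟨hty.symm, hy.1⟩, hy.2⟩
  · refine ⟨x, fun t _ htx => ⟨⟨x, ?_⟩, aux t A₂ (by omega)⟩⟩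
    simp only [mem_inter, mem_erase] at hx ⊢
    exact ⟨⟨htx.symm, hx.1⟩, hx.2⟩

/-- If `A₁` and `A₂` are joined in the link of the `(ℓ - 2)`-set `S`, then a set `T` which meets
both of them spans an edge together with a suitable part of `S`. -/
theorem DispersePred.exists_edge_of_join {E : Finset V → Prop} {ℓ : ℕ} (h : DispersePred E ℓ)
    {S A₁ A₂ : Finset V} (hS : #S + 2 = ℓ) (hSA : Disjoint S (A₁ ∪ A₂)) (hA : Disjoint A₁ A₂)
    (hjoin : ∀ x ∈ A₁, ∀ y ∈ A₂, E (insert x (insert y S))) (k : ℕ) :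
    ∀ U T : Finset V, U ⊆ S → #(S \ U) = k + 1 → T ⊆ A₁ ∪ A₂ → #T = k + 2 →
      (T ∩ A₁).Nonempty → (T ∩ A₂).Nonempty → ∃ u ∈ S \ U, E (insert u U ∪ T) := by
  induction k with
  | zero =>
    intro U T hU hSU hT hTc ⟨x, hx⟩ ⟨y, hy⟩
    obtain ⟨u, hu⟩ := card_eq_one.1 hSU
    refine ⟨u, by simp [hu], ?_⟩
    simp only [mem_inter] at hx hy
    have hxy : x ≠ y := fun e => disjoint_left.1 hA hx.2 (e ▸ hy.2)
    have hT' : ({x, y} : Finset V) = T := by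
      refine eq_of_subset_of_card_le ?_ (by rw [card_pair hxy, hTc])
      intro z hz
      simp only [mem_insert, mem_singleton] at hz
      rcases hz with rfl | rfl
      exacts [hx.1, hy.1]
    have hS' : insert u U = S := by
      rw [insert_eq, ← hu, sdiff_union_of_subset hU]
    rw [hS', ← hT', union_comm, insert_union, singleton_union]
    exact hjoin x hx.2 y hy.2
  | succ k ih =>
    intro U T hU hSU hT hTc h1 h2
    obtain ⟨u₀, hu₀⟩ : (S \ U).Nonempty := by rw [← card_pos]; omega
    have hu₀' := mem_sdiff.1 hu₀
    obtain ⟨t₀, ht₀⟩ := exists_forall_erase_inter_nonempty hA hT (by omega) h1 h2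
    have hsd : S \ insert u₀ U = (S \ U).erase u₀ := by rw [sdiff_insert]
    have hsdc : #(S \ insert u₀ U) = k + 1 := by
      rw [hsd, card_erase_of_mem hu₀, hSU]; rfl
    have hex : ∀ t ∈ T.erase t₀, ∃ v ∈ S \ insert u₀ U,
        E (insert v (insert u₀ U) ∪ T.erase t) := by
      intro t ht
      have ht' := mem_erase.1 ht
      obtain ⟨m1, m2⟩ := ht₀ t ht'.2 ht'.1
      refine ih _ _ (insert_subset hu₀'.1 hU) hsdc ((erase_subset _ _).trans hT) ?_ m1 m2
      rw [card_erase_of_mem ht'.2, hTc]; rfl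
    choose! f hf hfE using hex
    have hpred := pred_card_le_card_erase (s := T) (a := t₀)
    -- There are at least `k + 2` admissible deletions `t` and only `k + 1` values of `f`. A
    -- repeated value `v` gives two edges, omitting `t` and `t'`, in `U ∪ {u₀, v} ∪ T`; so omitting
    -- `u₀` or omitting `v` leaves an edge too.
    obtain ⟨t, ht, t', ht', htt, hft⟩ := exists_ne_map_eq_of_card_lt_of_maps_to
      (s := T.erase t₀) (t := S \ insert u₀ U) (f := f) (by omega) hf
    set v := f t with hv
    have hvm := hf t ht
    rw [← hv, hsd, mem_erase, mem_sdiff] at hvm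
    have e1 := hfE t ht
    have e2 := hfE t' ht'
    rw [← hft] at e2
    rw [← hv] at e1
    have ht := mem_of_mem_erase ht
    have ht' := mem_of_mem_erase ht'
    have hdis : ∀ x ∈ T, x ∉ S := fun x hx hxS => disjoint_left.1 hSA hxS (hT hx)
    have hVsub : insert v (insert u₀ U) ⊆ S :=
      insert_subset hvm.2.1 (insert_subset hu₀'.1 hU)
    have huT : u₀ ∉ T := fun hh => hdis _ hh hu₀'.1
    have hvT : v ∉ T := fun hh => hdis _ hh hvm.2.1
    have hvU : v ∉ insert u₀ U := by
      rw [mem_insert]; exact fun hh => hh.elim hvm.1 hvm.2.2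
    have hXc : #(insert v (insert u₀ U) ∪ T) = ℓ + 1 := by
      rw [card_union_of_disjoint (disjoint_left.2 fun x hx hxT => hdis x hxT (hVsub hx)),
        card_insert_of_notMem hvU, card_insert_of_notMem hu₀'.2]
      have := card_sdiff_add_card_eq_card hU
      omega
    by_contra hcon
    push Not at hcon
    have n1 := hcon u₀ hu₀
    have n2 := hcon v (mem_sdiff.2 hvm.2)
    refine h.erase hXc (x := t) (y := t') (z := u₀) (w := v) (by simp [ht]) (by simp [ht'])
      (by simp) (by simp) htt (Ne.symm hvm.1) ?_ ?_ ?_ ?_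
    · rwa [erase_union_of_notMem_left fun hh => hdis t ht (hVsub hh)]
    · rwa [erase_union_of_notMem_left fun hh => hdis t' ht' (hVsub hh)]
    · rwa [erase_union_of_notMem_right huT, insert_comm, erase_insert]
      rw [mem_insert]; exact fun hh => hh.elim (Ne.symm hvm.1) hu₀'.2
    · rwa [erase_union_of_notMem_right hvT, erase_insert hvU]

/-- If `A = A₁ ∪ A₂` is a component in the link of the `(ℓ - 2)`-set `S`, where `A₁` and `A₂` are
joined, then no edge consists of vertices of `A`, vertices of `S` and one further vertex. -/
theorem DispersePred.not_edge_of_component {E : Finset V → Prop} {ℓ : ℕ} (h : DispersePred E ℓ)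
    {S A₁ A₂ : Finset V} (hS : #S + 2 = ℓ) (hSA : Disjoint S (A₁ ∪ A₂)) (hA : Disjoint A₁ A₂)
    (hA1 : A₁.Nonempty) (hA2 : A₂.Nonempty)
    (hjoin : ∀ x ∈ A₁, ∀ y ∈ A₂, E (insert x (insert y S))) {b : V} (hbS : b ∉ S)
    (hbA : b ∉ A₁ ∪ A₂) (hb : ∀ a ∈ A₁ ∪ A₂, ¬ E (insert a (insert b S))) (k : ℕ) :
    ∀ U T : Finset V, U ⊆ S → #(S \ U) = k → T ⊆ A₁ ∪ A₂ → #T = k + 1 →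
      ¬ E (U ∪ insert b T) := by
  induction k with
  | zero =>
    intro U T hU hSU hT hTc
    obtain ⟨a, rfl⟩ := card_eq_one.1 hTc
    have hUS : U = S := hU.antisymm (sdiff_eq_empty_iff_subset.1 (card_eq_zero.1 hSU))
    have : S ∪ insert b {a} = insert a (insert b S) := by
      ext x; simp only [mem_union, mem_insert, mem_singleton]; tauto
    rw [hUS, this]
    exact hb a (hT (by simp))
  | succ k ih =>
    intro U T hU hSU hT hTc
    have hUc := card_sdiff_add_card_eq_card hU
    have hdisS : ∀ x ∈ A₁ ∪ A₂, x ∉ S := fun x hx hxS => disjoint_left.1 hSA hxS hx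
    -- an edge `U ∪ T ∪ {b}` excludes the edges `U ∪ T ∪ {u}`
    have step1 : ∀ T : Finset V, T ⊆ A₁ ∪ A₂ → #T = k + 2 → E (U ∪ insert b T) →
        ∀ u ∈ S \ U, ¬ E (insert u U ∪ T) := by
      intro T hT hTc hE u hu hEu
      have hu' := mem_sdiff.1 hu
      have hbT : b ∉ T := fun hh => hbA (hT hh)
      have hVS : insert u U ⊆ S := insert_subset hu'.1 hU
      have hdis : Disjoint (insert u U) (insert b T) := by
        rw [disjoint_left]
        intro x hx hxT
        rcases mem_insert.1 hxT with rfl | hxT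
        · exact hbS (hVS hx)
        · exact hdisS x (hT hxT) (hVS hx)
      have hXc : #(insert u U ∪ insert b T) = ℓ + 1 := by
        rw [card_union_of_disjoint hdis, card_insert_of_notMem hu'.2, card_insert_of_notMem hbT]
        omega
      obtain ⟨t, ht, t', ht', htt⟩ := one_lt_card.1 (show 1 < #T by omega)
      have hno : ∀ t ∈ T, ¬ E ((insert u U ∪ insert b T).erase t) := by
        intro t ht
        rw [erase_union_of_notMem_left fun hh => hdisS t (hT ht) (hVS hh),
          erase_insert_of_ne fun e : b = t => hbT (e ▸ ht)]
        refine ih _ _ hVS ?_ ((erase_subset _ _).trans hT) ?_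
        · rw [sdiff_insert, card_erase_of_mem hu, hSU]; rfl
        · rw [card_erase_of_mem ht, hTc]; rfl
      refine h.erase hXc (x := u) (y := b) (by simp) (by simp) (by simp [ht]) (by simp [ht'])
        ?_ htt ?_ ?_ (hno t ht) (hno t' ht')
      · rintro rfl; exact hbS hu'.1
      · rwa [erase_union_of_notMem_right, erase_insert hu'.2]
        exact fun hh => disjoint_left.1 hdis (mem_insert_self _ _) hh
      · rwa [erase_union_of_notMem_left, erase_insert hbT]
        exact fun hh => hbS (hVS hh)
    have step2 : ∀ T : Finset V, T ⊆ A₁ ∪ A₂ → #T = k + 2 → (T ∩ A₁).Nonempty →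
        (T ∩ A₂).Nonempty → ¬ E (U ∪ insert b T) := by
      intro T hT hTc m1 m2 hE
      obtain ⟨u, hu, hEu⟩ := h.exists_edge_of_join hS hSA hA hjoin k U T hU hSU hT hTc m1 m2
      exact step1 T hT hTc hE u hu hEu
    intro hE
    -- a vertex `z` of `A` such that every set `T - t + z` meets both `A₁` and `A₂`
    obtain ⟨z, hzA, hzT, hz⟩ : ∃ z ∈ A₁ ∪ A₂, z ∉ T ∧ ∀ t ∈ T,
        (insert z (T.erase t) ∩ A₁).Nonempty ∧ (insert z (T.erase t) ∩ A₂).Nonempty := by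
      by_cases m1 : (T ∩ A₁).Nonempty
      · by_cases m2 : (T ∩ A₂).Nonempty
        · exact absurd hE (step2 T hT hTc m1 m2)
        · obtain ⟨z, hz⟩ := hA2
          rw [not_nonempty_iff_eq_empty] at m2
          have hzT : z ∉ T := fun hh => notMem_empty z (m2 ▸ mem_inter.2 ⟨hh, hz⟩)
          have hTA : T ⊆ A₁ := fun x hx => (mem_union.1 (hT hx)).resolve_right fun hh =>
            notMem_empty x (m2 ▸ mem_inter.2 ⟨hx, hh⟩)
          refine ⟨z, mem_union_right _ hz, hzT, fun t ht => ⟨?_, z, by simp [hz]⟩⟩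
          obtain ⟨x, hx⟩ : (T.erase t).Nonempty := by
            rw [← card_pos, card_erase_of_mem ht]; omega
          exact ⟨x, mem_inter.2 ⟨mem_insert_of_mem hx, hTA (mem_of_mem_erase hx)⟩⟩
      · obtain ⟨z, hz⟩ := hA1
        rw [not_nonempty_iff_eq_empty] at m1
        have hzT : z ∉ T := fun hh => notMem_empty z (m1 ▸ mem_inter.2 ⟨hh, hz⟩)
        have hTA : T ⊆ A₂ := fun x hx => (mem_union.1 (hT hx)).resolve_left fun hh =>
          notMem_empty x (m1 ▸ mem_inter.2 ⟨hx, hh⟩)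
        refine ⟨z, mem_union_left _ hz, hzT, fun t ht => ⟨⟨z, by simp [hz]⟩, ?_⟩⟩
        obtain ⟨x, hx⟩ : (T.erase t).Nonempty := by
          rw [← card_pos, card_erase_of_mem ht]; omega
        exact ⟨x, mem_inter.2 ⟨mem_insert_of_mem hx, hTA (mem_of_mem_erase hx)⟩⟩
    have hzt : ∀ t ∈ T, #(insert z (T.erase t)) = k + 2 := by
      intro t ht
      rw [card_insert_of_notMem fun hh => hzT (mem_of_mem_erase hh), card_erase_of_mem ht, hTc]
      rfl
    have hztA : ∀ t, insert z (T.erase t) ⊆ A₁ ∪ A₂ := fun t =>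
      insert_subset hzA ((erase_subset _ _).trans hT)
    have hbz : b ≠ z := fun e => hbA (e ▸ hzA)
    have hbT : b ∉ T := fun hh => hbA (hT hh)
    have hzTA : insert z T ⊆ A₁ ∪ A₂ := insert_subset hzA hT
    have hUz : ∀ W ⊆ S, Disjoint W (insert z T) := fun W hW => disjoint_left.2 fun x hx hxT =>
      hdisS x (hzTA hxT) (hW hx)
    obtain ⟨t, ht, t', ht', htt⟩ := one_lt_card.1 (show 1 < #T by omega)
    have hzer : ∀ t ∈ T, (insert z T).erase t = insert z (T.erase t) := fun t ht =>
      erase_insert_of_ne fun e : z = t => hzT (e ▸ ht)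
    -- In `U ∪ {b, z} ∪ T`, deleting any `t ∈ T` leaves a non-edge by `step2`, so at most one edge
    -- remains, and deleting `z` already yields the assumed one.
    have n1 : ¬ E (U ∪ insert z T) := by
      intro hE'
      have hdis : Disjoint U (insert b (insert z T)) := by
        rw [disjoint_insert_right]
        exact ⟨fun hh => hbS (hU hh), hUz U hU⟩
      have hbzT : b ∉ insert z T := fun hh => hbA (hzTA hh)
      have hXc : #(U ∪ insert b (insert z T)) = ℓ + 1 := by
        rw [card_union_of_disjoint hdis, card_insert_of_notMem hbzT, card_insert_of_notMem hzT]
        omega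
      have hno : ∀ t ∈ T, ¬ E ((U ∪ insert b (insert z T)).erase t) := by
        intro t ht
        rw [erase_union_of_notMem_left fun hh => hdisS t (hT ht) (hU hh),
          erase_insert_of_ne fun e : b = t => hbT (e ▸ ht), hzer t ht]
        exact step2 _ (hztA t) (hzt t ht) (hz t ht).1 (hz t ht).2
      refine h.erase hXc (x := z) (y := b) (by simp) (by simp) (by simp [ht]) (by simp [ht'])
        hbz.symm htt ?_ ?_ (hno t ht) (hno t' ht')
      · rwa [erase_union_of_notMem_left fun hh => hdisS z hzA (hU hh),
          erase_insert_of_ne hbz, erase_insert hzT]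
      · rwa [erase_union_of_notMem_left fun hh => hbS (hU hh), erase_insert hbzT]
    have hex : ∀ t ∈ T, ∃ u ∈ S \ U, E (insert u U ∪ insert z (T.erase t)) := fun t ht =>
      h.exists_edge_of_join hS hSA hA hjoin k U _ hU hSU (hztA t) (hzt t ht) (hz t ht).1 (hz t ht).2
    choose! f hf hfE using hex
    -- Pigeonhole with `k + 2` elements of `T` and `k + 1` of `S \ U`. In `U ∪ {u, z} ∪ T`, deleting
    -- `t` or `t'` leaves an edge, while deleting `u` (by `n1`) or `z` (by `step1`) leaves none.
    obtain ⟨t, ht, t', ht', htt, hft⟩ := exists_ne_map_eq_of_card_lt_of_maps_to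
      (s := T) (t := S \ U) (f := f) (by omega) hf
    set u := f t with hu
    have hum := hf t ht
    rw [← hu] at hum
    have hu' := mem_sdiff.1 hum
    have e1 := hfE t ht
    have e2 := hfE t' ht'
    rw [← hft] at e2
    rw [← hu] at e1
    have hVS : insert u U ⊆ S := insert_subset hu'.1 hU
    have hXc : #(insert u U ∪ insert z T) = ℓ + 1 := by
      rw [card_union_of_disjoint (hUz _ hVS), card_insert_of_notMem hu'.2,
        card_insert_of_notMem hzT]
      omega
    refine h.erase hXc (x := t) (y := t') (z := u) (w := z) (by simp [ht]) (by simp [ht'])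
      (by simp) (by simp) htt ?_ ?_ ?_ ?_ ?_
    · intro e; exact hdisS z hzA (e ▸ hu'.1)
    · rwa [erase_union_of_notMem_left fun hh => hdisS t (hT ht) (hVS hh), hzer t ht]
    · rwa [erase_union_of_notMem_left fun hh => hdisS t' (hT ht') (hVS hh), hzer t' ht']
    · rwa [erase_union_of_notMem_right, erase_insert hu'.2]
      exact fun hh => hdisS u (hzTA hh) hu'.1
    · rw [erase_union_of_notMem_left fun hh => hdisS z hzA (hVS hh), erase_insert hzT]
      exact step1 T hT hTc hE u hum

end Structure

/-! ### Sparse cuts, and the alternative of uniformly small degrees. -/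

section Cuts

open scoped Classical

variable {V : Type*} [DecidableEq V]

/-- Fix one extension `a` and two elements `y`, `y'` of `J`. For any other extension `x`, the set `I
∪ {a, x} ∪ J` has two edges, so deleting `y` or `y'` leaves an edge. Thus `x` extends `I ∪ {a}`
together with `J - y` or `J - y'`, and the bound at most doubles with each element of `J`. -/
theorem DispersePred.card_extension_le {E : Finset V → Prop} {ℓ : ℕ} (h : DispersePred E ℓ)
    {A B : Finset V} (hAB : Disjoint A B)
    (hno : ∀ T ⊆ A, #T + 1 = ℓ → ∀ b ∈ B, ¬ E (insert b T)) (j : ℕ) :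
    ∀ I J : Finset V, I ⊆ A → J ⊆ B → #J = j + 1 → #I + #J + 1 = ℓ →
      #{a ∈ A \ I | E (insert a I ∪ J)} + 1 ≤ 2 ^ j := by
  induction j with
  | zero =>
    intro I J hI hJ hJc hc
    obtain ⟨b, rfl⟩ := card_eq_one.1 hJc
    rw [filter_false_of_mem]
    · simp
    · intro a ha
      rw [mem_sdiff] at ha
      rw [union_comm, singleton_union]
      refine hno _ (insert_subset ha.1 hI) ?_ b (hJ (by simp))
      rw [card_insert_of_notMem ha.2]
      omega
  | succ j ih =>
    intro I J hI hJ hJc hc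
    set N := {a ∈ A \ I | E (insert a I ∪ J)} with hN
    rcases N.eq_empty_or_nonempty with h0 | ⟨a, ha⟩
    · rw [h0, card_empty]; exact Nat.one_le_two_pow
    obtain ⟨y, hy, y', hy', hyy⟩ := one_lt_card.1 (show 1 < #J by omega)
    have ha' := ha
    simp only [hN, mem_filter, mem_sdiff] at ha'
    obtain ⟨⟨haA, haI⟩, haE⟩ := ha'
    have hAJ : ∀ x ∈ A, x ∉ J := fun x hx hxJ => disjoint_left.1 hAB hx (hJ hxJ)
    have hsub : N.erase a ⊆ {x ∈ A \ insert a I | E (insert x (insert a I) ∪ J.erase y)} ∪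
        {x ∈ A \ insert a I | E (insert x (insert a I) ∪ J.erase y')} := by
      intro x hx
      simp only [hN, mem_erase, mem_filter, mem_sdiff] at hx
      obtain ⟨hxa, ⟨hxA, hxI⟩, hxE⟩ := hx
      have hxm : x ∈ A \ insert a I := by
        rw [mem_sdiff, mem_insert]; exact ⟨hxA, fun k => k.elim hxa hxI⟩
      have hxaI : x ∉ insert a I := (mem_sdiff.1 hxm).2
      have haxI : a ∉ insert x I := by
        rw [mem_insert]; exact fun k => k.elim hxa.symm haI
      have hsubA : insert x (insert a I) ⊆ A := insert_subset hxA (insert_subset haA hI)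
      by_contra hcon
      rw [mem_union, mem_filter, mem_filter, not_or] at hcon
      have n1 := fun k => hcon.1 ⟨hxm, k⟩
      have n2 := fun k => hcon.2 ⟨hxm, k⟩
      have hXc : #(insert x (insert a I) ∪ J) = ℓ + 1 := by
        rw [card_union_of_disjoint (disjoint_left.2 fun z hz => hAJ z (hsubA hz)),
          card_insert_of_notMem hxaI, card_insert_of_notMem haI]
        omega
      have hyX : ∀ z ∈ J, z ∉ insert x (insert a I) := fun z hz hh => hAJ z (hsubA hh) hz
      refine h.erase hXc (x := x) (y := a) (z := y) (w := y') (by simp) (by simp) (by simp [hy])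
        (by simp [hy']) hxa hyy ?_ ?_ ?_ ?_
      · rwa [erase_union_of_notMem_right (hAJ x hxA), erase_insert hxaI]
      · rwa [erase_union_of_notMem_right (hAJ a haA), insert_comm, erase_insert haxI]
      · rwa [erase_union_of_notMem_left (hyX y hy)]
      · rwa [erase_union_of_notMem_left (hyX y' hy')]
    have hI' : insert a I ⊆ A := insert_subset haA hI
    have hIc := card_insert_of_notMem haI
    have hb : ∀ z ∈ J, #{x ∈ A \ insert a I | E (insert x (insert a I) ∪ J.erase z)} + 1 ≤ 2 ^ j := by
      intro z hz
      have hzc := card_erase_of_mem hz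
      exact ih _ _ hI' ((erase_subset _ _).trans hJ) (by omega) (by omega)
    have h1 := card_le_card hsub
    have h2 := card_union_le {x ∈ A \ insert a I | E (insert x (insert a I) ∪ J.erase y)}
      {x ∈ A \ insert a I | E (insert x (insert a I) ∪ J.erase y')}
    have h3 := hb y hy
    have h4 := hb y' hy'
    have h5 := card_erase_of_mem ha
    rw [pow_succ]
    omega

/-- The `ℓ`-sets satisfying `E` which meet both `X` and `Y`. -/
noncomputable def crossing (E : Finset V → Prop) (ℓ : ℕ) (X Y : Finset V) : Finset (Finset V) :=
  {e ∈ powersetCard ℓ (X ∪ Y) | E e ∧ (e ∩ X).Nonempty ∧ (e ∩ Y).Nonempty}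

theorem card_filter_inter_nonempty {X Y : Finset V} (hXY : Disjoint X Y) (k : ℕ) :
    #{R ∈ powersetCard k (X ∪ Y) | (R ∩ Y).Nonempty} + (#X).choose k = (#(X ∪ Y)).choose k := by
  rw [← card_powersetCard k (X ∪ Y), ← card_powersetCard k X,
    ← card_filter_add_card_filter_not (s := powersetCard k (X ∪ Y)) (fun R => (R ∩ Y).Nonempty)]
  congr 2
  ext R
  simp only [mem_powersetCard, mem_filter, not_nonempty_iff_eq_empty, ← disjoint_iff_inter_eq_empty]
  constructor
  · rintro ⟨h1, h2⟩
    exact ⟨⟨h1.trans subset_union_left, h2⟩, hXY.mono_left h1⟩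
  · rintro ⟨⟨h1, h2⟩, h3⟩
    exact ⟨h3.left_le_of_le_sup_right h1, h2⟩

/-- Delete from a crossing edge a vertex of `S` if there is one, otherwise a vertex of `A`. The
remaining `(ℓ - 1)`-set `R` still meets `Y`, and the edge is recovered from `R` in at most `ℓ` ways
through `S` and at most `2 ^ ℓ` ways through `A`, by `DispersePred.card_extension_le`. -/
theorem DispersePred.card_crossing_le {E : Finset V → Prop} {ℓ : ℕ} (h : DispersePred E ℓ)
    {S A Y : Finset V} (hS : #S + 2 = ℓ) (hXY : Disjoint (A ∪ S) Y)
    (hno : ∀ T ⊆ A, #T + 1 = ℓ → ∀ b ∈ Y, ¬ E (insert b T)) :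
    #(crossing E ℓ (A ∪ S) Y) ≤
      #{R ∈ powersetCard (ℓ - 1) (A ∪ S ∪ Y) | (R ∩ Y).Nonempty} * (2 ^ ℓ + ℓ) := by
  set N : Finset V → Finset V := fun R => {a ∈ A \ R | Disjoint R S ∧ E (insert a R)} with hN
  have hAY : Disjoint A Y := hXY.mono_left subset_union_left
  have hsub : crossing E ℓ (A ∪ S) Y ⊆
      ({R ∈ powersetCard (ℓ - 1) (A ∪ S ∪ Y) | (R ∩ Y).Nonempty}).biUnion
        fun R => (N R ∪ S).image fun x => insert x R := by
    intro e he
    simp only [crossing, mem_filter, mem_powersetCard] at he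
    obtain ⟨⟨heW, hec⟩, heE, ⟨x, hx⟩, ⟨y, hy⟩⟩ := he
    rw [mem_inter] at hx hy
    have main : ∀ x ∈ e, x ∈ A ∪ S → x ∈ N (e.erase x) ∪ S →
        e ∈ ({R ∈ powersetCard (ℓ - 1) (A ∪ S ∪ Y) | (R ∩ Y).Nonempty}).biUnion
        fun R => (N R ∪ S).image fun x => insert x R := by
      intro x hxe hxX hxN
      rw [mem_biUnion]
      refine ⟨e.erase x, ?_, mem_image.2 ⟨x, hxN, insert_erase hxe⟩⟩
      rw [mem_filter, mem_powersetCard, card_erase_of_mem hxe, hec]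
      refine ⟨⟨(erase_subset _ _).trans heW, rfl⟩, y, ?_⟩
      rw [mem_inter, mem_erase]
      exact ⟨⟨fun k => disjoint_left.1 hXY hxX (k ▸ hy.2), hy.1⟩, hy.2⟩
    by_cases hd : Disjoint e S
    · have hxA : x ∈ A := (mem_union.1 hx.2).resolve_right (disjoint_left.1 hd hx.1)
      refine main x hx.1 hx.2 (mem_union_left _ ?_)
      simp only [hN, mem_filter, mem_sdiff]
      exact ⟨⟨hxA, notMem_erase _ _⟩, hd.mono_left (erase_subset _ _), by
        rwa [insert_erase hx.1]⟩
    · obtain ⟨s, hse, hsS⟩ := not_disjoint_iff.1 hd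
      exact main s hse (mem_union_right _ hsS) (mem_union_right _ hsS)
  refine (card_le_card hsub).trans (card_biUnion_le_card_mul _ _ _ ?_)
  intro R hR
  rw [mem_filter, mem_powersetCard] at hR
  obtain ⟨⟨hRW, hRc⟩, hRY⟩ := hR
  refine card_image_le.trans ((card_union_le _ _).trans (add_le_add ?_ (by omega)))
  by_cases hd : Disjoint R S
  · have hRAY : R ∩ A ∪ R ∩ Y = R := by
      rw [← inter_union_distrib_left, inter_eq_left]
      intro z hz
      have := hRW hz
      simp only [mem_union] at this ⊢
      have := disjoint_left.1 hd hz
      tauto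
    have hcard : #(R ∩ A) + #(R ∩ Y) = #R := by
      rw [← card_union_of_disjoint (hAY.mono inter_subset_right inter_subset_right), hRAY]
    have hpos := hRY.card_pos
    have hNeq : N R = {a ∈ A \ (R ∩ A) | E (insert a (R ∩ A) ∪ (R ∩ Y))} := by
      ext a
      simp only [hN, mem_filter, mem_sdiff, mem_inter, insert_union, hRAY]
      tauto
    have := h.card_extension_le hAY hno (#(R ∩ Y) - 1) (R ∩ A) (R ∩ Y) inter_subset_right
      inter_subset_right (by omega) (by omega)
    rw [hNeq]
    have h2 : 2 ^ (#(R ∩ Y) - 1) ≤ 2 ^ ℓ := Nat.pow_le_pow_right (by norm_num) (by omega)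
    omega
  · have : N R = ∅ := by
      simp only [hN]
      exact filter_false_of_mem fun a _ hh => hd hh.1
    simp [this]

/-- `W` splits into `X`, of size at least `m`, and `Y` with few crossing `ℓ`-sets satisfying
`E`. -/
def HasSparseCut (E : Finset V → Prop) (ℓ m : ℕ) (W : Finset V) : Prop :=
  ∃ X Y : Finset V, X.Nonempty ∧ Y.Nonempty ∧ Disjoint X Y ∧ X ∪ Y = W ∧ m ≤ #X ∧
    #(crossing E ℓ X Y) + (2 ^ ℓ + ℓ) * (#X).choose (ℓ - 1) ≤
      (2 ^ ℓ + ℓ) * (#(X ∪ Y)).choose (ℓ - 1)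

/-- The set `R` has fewer than `m` extensions to an edge inside `W`. -/
def HasSmallDegree (E : Finset V → Prop) (m : ℕ) (W R : Finset V) : Prop :=
  #{x ∈ W \ R | E (insert x R)} < m

/-- The cut takes the component of `w` in the link together with `S` as its first side. Every
neighbour of `w` lies in that component, so the degree assumption makes this side large. -/
theorem DispersePred.hasSparseCut_of_split {E : Finset V → Prop} {ℓ m : ℕ}
    (h : DispersePred E ℓ) (hℓ : 3 ≤ ℓ) (hm : 1 ≤ m) {W S X₀ Y₀ : Finset V} (hSW : S ⊆ W)
    (hS : #S = ℓ - 2) (hX : X₀.Nonempty) (hY : Y₀.Nonempty) (hd : Disjoint X₀ Y₀)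
    (hU : X₀ ∪ Y₀ = W \ S) (hno : ∀ x ∈ X₀, ∀ y ∈ Y₀, ¬ E (insert x (insert y S)))
    {w : V} (hw : w ∈ W \ S) (hdeg : ¬ HasSmallDegree E m W (insert w S)) :
    HasSparseCut E ℓ m W := by
  rw [HasSmallDegree, not_lt] at hdeg
  have hg : ∀ x y : V, E (insert x (insert y S)) → E (insert y (insert x S)) :=
    fun x y k => insert_comm x y S ▸ k
  obtain ⟨z, hz⟩ : ({x ∈ W \ insert w S | E (insert x (insert w S))}).Nonempty := by
    rw [← card_pos]; omega
  simp only [mem_filter, mem_sdiff, mem_insert, not_or] at hz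
  obtain ⟨A₁, A₂, hA1, hA2, hA, hAW, hjoin, hcl, hwA, hnb⟩ :=
    (h.pathFourFree hℓ hS (W \ S) sdiff_disjoint).exists_component hg hX hY hd hU hno hw
      (mem_sdiff.2 ⟨hz.1.1, hz.1.2.2⟩) hz.1.2.1 (hg _ _ hz.2)
  have hSA : Disjoint S (A₁ ∪ A₂) := (disjoint_sdiff (s := S) (t := W)).mono_right hAW.subset
  have hS' : #S + 2 = ℓ := by omega
  set A := A₁ ∪ A₂ with hAdef
  set Y := (W \ S) \ A with hYdef
  have hYm : ∀ b ∈ Y, b ∉ S ∧ b ∉ A := fun b hb =>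
    ⟨(mem_sdiff.1 (mem_sdiff.1 hb).1).2, (mem_sdiff.1 hb).2⟩
  have hAW' : A ⊆ W := hAW.subset.trans sdiff_subset
  have hXY : Disjoint (A ∪ S) Y := by
    rw [disjoint_left]
    intro x hx hxY
    have := hYm x hxY
    rcases mem_union.1 hx with hx | hx <;> tauto
  have hunion : A ∪ S ∪ Y = W := by
    ext x
    simp only [hYdef, mem_union, mem_sdiff]
    have := @hAW' x
    have := @hSW x
    tauto
  refine ⟨A ∪ S, Y, ⟨w, mem_union_left _ hwA⟩, sdiff_nonempty.2 fun k => hAW.2 k, hXY, hunion,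
    ?_, ?_⟩
  · refine hdeg.trans (card_le_card ?_)
    intro x hx
    simp only [mem_filter, mem_sdiff, mem_insert, not_or] at hx
    exact mem_union_left _ (hnb x (mem_sdiff.2 ⟨hx.1.1, hx.1.2.2⟩) (hg _ _ hx.2))
  · have hcross := h.card_crossing_le (S := S) (A := A) (Y := Y) hS' hXY (by
      intro T hT hTc b hb
      have := h.not_edge_of_component hS' hSA hA hA1 hA2 hjoin (hYm b hb).1 (hYm b hb).2
        (fun a ha => hcl a ha b hb) (#S) ∅ T (empty_subset _) (by simp) hT (by omega)
      rwa [empty_union] at this)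
    -- The `(ℓ - 1)`-sets meeting `Y` number the difference of two binomials; this form telescopes
    -- when cuts are iterated.
    have := card_filter_inter_nonempty hXY (ℓ - 1)
    rw [← this, mul_add, mul_comm (2 ^ ℓ + ℓ) (#{R ∈ _ | _})]
    omega

theorem DispersePred.smallDegree_or_hasSparseCut {E : Finset V → Prop} {ℓ m : ℕ}
    (h : DispersePred E ℓ) (hℓ : 3 ≤ ℓ) (hm : 1 ≤ m) {W S : Finset V} (hW : ℓ ≤ #W) (hSW : S ⊆ W)
    (hS : #S = ℓ - 2) :
    (∀ w ∈ W \ S, HasSmallDegree E m W (insert w S)) ∨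
    (∀ w ∈ W \ S, HasSmallDegree (fun e => ¬ E e) m W (insert w S)) ∨
    HasSparseCut E ℓ m W ∨ HasSparseCut (fun e => ¬ E e) ℓ m W := by
  have hg : ∀ x y : V, E (insert x (insert y S)) → E (insert y (insert x S)) :=
    fun x y k => insert_comm x y S ▸ k
  have hc := card_sdiff_of_subset hSW
  obtain ⟨X, Y, hX, hY, hd, hU, hh⟩ :=
    (h.pathFourFree hℓ hS (W \ S) sdiff_disjoint).exists_split hg (W \ S) (by omega)
  rcases hh with hall | hno
  · by_cases hlow : ∀ w ∈ W \ S, HasSmallDegree (fun e => ¬ E e) m W (insert w S)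
    · exact Or.inr (Or.inl hlow)
    · push Not at hlow
      obtain ⟨w, hw, hdeg⟩ := hlow
      exact Or.inr (Or.inr (Or.inr (h.compl.hasSparseCut_of_split hℓ hm hSW hS hX hY hd hU
        (fun x hx y hy => not_not.2 (hall x hx y hy)) hw hdeg)))
  · by_cases hlow : ∀ w ∈ W \ S, HasSmallDegree E m W (insert w S)
    · exact Or.inl hlow
    · push Not at hlow
      obtain ⟨w, hw, hdeg⟩ := hlow
      exact Or.inr (Or.inr (Or.inl (h.hasSparseCut_of_split hℓ hm hSW hS hX hY hd hU hno hw hdeg)))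

/-- A property of `k`-subsets of `W` which passes between sets differing in one element holds for
all or none of the `k`-subsets. -/
theorem forall_of_exchange {W : Finset V} {k : ℕ} {p : Finset V → Prop}
    (hp : ∀ R ⊆ W, #R = k → ∀ r ∈ R, ∀ s ∈ W, s ∉ R → p R → p (insert s (R.erase r)))
    {R' : Finset V} (hR' : R' ⊆ W) (hR'c : #R' = k) (d : ℕ) :
    ∀ R ⊆ W, #R = k → #(R' \ R) = d → p R → p R' := by
  induction d with
  | zero =>
    intro R _ hRc hd hpR
    have := sdiff_eq_empty_iff_subset.1 (card_eq_zero.1 hd)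
    rwa [eq_of_subset_of_card_le this (by omega)]
  | succ d ih =>
    intro R hRW hRc hd hpR
    obtain ⟨s, hs⟩ : (R' \ R).Nonempty := by rw [← card_pos]; omega
    obtain ⟨r, hr⟩ : (R \ R').Nonempty := by
      rw [← card_pos, card_sdiff_comm (by omega)]; omega
    rw [mem_sdiff] at hr
    have hs' := mem_sdiff.1 hs
    have hsr : s ∉ R.erase r := fun k => hs'.2 (mem_of_mem_erase k)
    refine ih (insert s (R.erase r)) (insert_subset (hR' hs'.1) ((erase_subset _ _).trans hRW))
      ?_ ?_ (hp R hRW hRc r hr.1 s (hR' hs'.1) hs'.2 hpR)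
    · rw [card_insert_of_notMem hsr, card_erase_of_mem hr.1]
      have := card_pos.2 ⟨r, hr.1⟩
      omega
    · have : R' \ insert s (R.erase r) = (R' \ R).erase s := by
        ext x
        simp only [mem_sdiff, mem_insert, mem_erase]
        constructor
        · rintro ⟨h1, h2⟩
          refine ⟨fun e => h2 (Or.inl e), h1, fun hxR => h2 (Or.inr ⟨?_, hxR⟩)⟩
          rintro rfl
          exact hr.2 h1
        · tauto
      rw [this, card_erase_of_mem hs, hd]
      rfl

/-- A large vertex set has a sparse or co-sparse cut, or all `(ℓ - 1)`-sets have small degree, or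
all have small codegree. -/
theorem DispersePred.uniform_or_hasSparseCut {E : Finset V → Prop} {ℓ m : ℕ}
    (h : DispersePred E ℓ) (hℓ : 3 ≤ ℓ) (hm : 1 ≤ m) {W : Finset V} (hW : 2 * m + ℓ ≤ #W) :
    (∀ R ⊆ W, #R = ℓ - 1 → HasSmallDegree E m W R) ∨
    (∀ R ⊆ W, #R = ℓ - 1 → HasSmallDegree (fun e => ¬ E e) m W R) ∨
    HasSparseCut E ℓ m W ∨ HasSparseCut (fun e => ¬ E e) ℓ m W := by
  by_contra hcon
  rw [not_or, not_or] at hcon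
  obtain ⟨hn1, hn2, hn3⟩ := hcon
  push Not at hn1 hn2
  obtain ⟨R, hRW, hRc, hR⟩ := hn1
  obtain ⟨R', hRW', hRc', hR'⟩ := hn2
  have key : ∀ R ⊆ W, #R = ℓ - 1 → ∀ r ∈ R,
      (∀ w ∈ W, w ∉ R.erase r → HasSmallDegree E m W (insert w (R.erase r))) ∨
      (∀ w ∈ W, w ∉ R.erase r → HasSmallDegree (fun e => ¬ E e) m W (insert w (R.erase r))) := by
    intro R hRW hRc r hr
    rcases h.smallDegree_or_hasSparseCut hℓ hm (S := R.erase r) (W := W) (by omega)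
      ((erase_subset _ _).trans hRW) (by rw [card_erase_of_mem hr]; omega) with k | k | k
    · exact Or.inl fun w hw hwR => k w (mem_sdiff.2 ⟨hw, hwR⟩)
    · exact Or.inr fun w hw hwR => k w (mem_sdiff.2 ⟨hw, hwR⟩)
    · exact absurd k hn3
  have hnot : ¬ HasSmallDegree E m W R' := by
    refine forall_of_exchange (p := fun R => ¬ HasSmallDegree E m W R) ?_ hRW' hRc' _ R hRW hRc rfl
      hR
    intro R hRW hRc r hr s hs hsR hpR hsm
    have hsr : s ∉ R.erase r := fun k => hsR (mem_of_mem_erase k)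
    rcases key R hRW hRc r hr with k | k
    · apply hpR
      have := k r (hRW hr) (notMem_erase _ _)
      rwa [insert_erase hr] at this
    -- The degree and codegree of the new set sum to `#W - (ℓ - 1)`, too large for both to be below
    -- `m`.
    · have hsm' : #{x ∈ W \ insert s (R.erase r) | ¬ E (insert x (insert s (R.erase r)))} < m := by
        have := k s hs hsr
        unfold HasSmallDegree at this
        convert this
      rw [HasSmallDegree] at hsm
      have hsub : insert s (R.erase r) ⊆ W := insert_subset hs ((erase_subset _ _).trans hRW)
      have := card_filter_add_card_filter_not (s := W \ insert s (R.erase r))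
        (fun x => E (insert x (insert s (R.erase r))))
      have hcs := card_sdiff_of_subset hsub
      rw [card_insert_of_notMem hsr, card_erase_of_mem hr] at hcs
      omega
  obtain ⟨r, hr⟩ : R'.Nonempty := by rw [← card_pos]; omega
  rcases key R' hRW' hRc' r hr with k | k
  · have := k r (hRW' hr) (notMem_erase _ _)
    rw [insert_erase hr] at this
    exact hnot this
  · have := k r (hRW' hr) (notMem_erase _ _)
    rw [insert_erase hr] at this
    exact hR' this

end Cuts

/-! ### Gluing cohypergraphs along cuts and counting the errors. -/

section Approximation

open scoped Classical

variable {V : Type*} [DecidableEq V]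

namespace UniformHypergraph

theorem IsCohypergraphOn.congr {ℓ : ℕ} {G G' : UniformHypergraph V ℓ} {W : Finset V}
    (hG : G.IsCohypergraphOn W) (h : ∀ e ⊆ W, e ∈ G.edges ↔ e ∈ G'.edges) :
    G'.IsCohypergraphOn W := by
  induction hG with
  | single v => exact .single v
  | join X Y hX hY hXY hGX hGY hc ihX ihY =>
    refine .join X Y hX hY hXY (ihX fun e he => h e (he.trans subset_union_left))
      (ihY fun e he => h e (he.trans subset_union_right)) ?_
    refine hc.imp (fun hc e he hce h1 h2 => (h e he).1 (hc e he hce h1 h2))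
      (fun hc e he hce h1 h2 k => hc e he hce h1 h2 ((h e he).2 k))

/-- The hypergraph on `X ∪ Y` which agrees with `H₁` on `X` and with `H₂` on `Y`, and contains all
or none of the crossing sets according to `b`. -/
noncomputable def glue {ℓ : ℕ} (H₁ H₂ : UniformHypergraph V ℓ) (X Y : Finset V) (b : Prop) :
    UniformHypergraph V ℓ where
  edges := {e ∈ powersetCard ℓ (X ∪ Y) | (e ⊆ X ∧ e ∈ H₁.edges) ∨ (e ⊆ Y ∧ e ∈ H₂.edges) ∨
    (¬ e ⊆ X ∧ ¬ e ⊆ Y ∧ b)}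
  card_of_mem := fun _ he => (mem_powersetCard.1 (mem_filter.1 he).1).2

section glue

theorem not_subset_right_of_subset_left {V : Type*} {ℓ : ℕ} {X Y e : Finset V} (hℓ : 0 < ℓ)
    (hXY : Disjoint X Y) (hec : #e = ℓ) (he : e ⊆ X) : ¬ e ⊆ Y := by
  intro he'
  have := disjoint_self_iff_empty e |>.1 (hXY.mono he he')
  rw [this, card_empty] at hec
  omega

variable {ℓ : ℕ} {H₁ H₂ : UniformHypergraph V ℓ} {X Y : Finset V} {b : Prop} {e : Finset V}

theorem mem_glue_edges : e ∈ (glue H₁ H₂ X Y b).edges ↔ (e ⊆ X ∪ Y ∧ #e = ℓ) ∧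
    ((e ⊆ X ∧ e ∈ H₁.edges) ∨ (e ⊆ Y ∧ e ∈ H₂.edges) ∨ (¬ e ⊆ X ∧ ¬ e ⊆ Y ∧ b)) := by
  rw [← mem_powersetCard, glue, mem_filter]

theorem glue_comm : (glue H₂ H₁ Y X b).edges = (glue H₁ H₂ X Y b).edges := by
  ext e
  rw [mem_glue_edges, mem_glue_edges, union_comm]
  tauto

theorem mem_glue_edges_left (hℓ : 0 < ℓ) (hXY : Disjoint X Y) (he : e ⊆ X) :
    e ∈ (glue H₁ H₂ X Y b).edges ↔ e ∈ H₁.edges := by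
  rw [mem_glue_edges]
  constructor
  · rintro ⟨⟨_, hec⟩, h | h | h⟩
    · exact h.2
    · exact absurd h.1 (not_subset_right_of_subset_left hℓ hXY hec he)
    · exact absurd he h.1
  · intro h
    exact ⟨⟨he.trans subset_union_left, H₁.card_of_mem e h⟩, Or.inl ⟨he, h⟩⟩

theorem mem_glue_edges_right (hℓ : 0 < ℓ) (hXY : Disjoint X Y) (he : e ⊆ Y) :
    e ∈ (glue H₁ H₂ X Y b).edges ↔ e ∈ H₂.edges := by
  rw [← glue_comm, mem_glue_edges_left hℓ hXY.symm he]

theorem not_subset_of_inter_nonempty (hXY : Disjoint X Y) (h : (e ∩ Y).Nonempty) : ¬ e ⊆ X := by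
  obtain ⟨y, hy⟩ := h
  rw [mem_inter] at hy
  exact fun k => disjoint_left.1 hXY (k hy.1) hy.2

theorem inter_nonempty_of_not_subset (heW : e ⊆ X ∪ Y) (h : ¬ e ⊆ X) : (e ∩ Y).Nonempty := by
  obtain ⟨y, hy, hyX⟩ := not_subset.1 h
  exact ⟨y, mem_inter.2 ⟨hy, (mem_union.1 (heW hy)).resolve_left hyX⟩⟩

theorem isCohypergraphOn_glue (hℓ : 0 < ℓ) (hX : X.Nonempty) (hY : Y.Nonempty)
    (hXY : Disjoint X Y) (h₁ : H₁.IsCohypergraphOn X) (h₂ : H₂.IsCohypergraphOn Y) :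
    (glue H₁ H₂ X Y b).IsCohypergraphOn (X ∪ Y) := by
  refine .join X Y hX hY hXY (h₁.congr fun e he => (mem_glue_edges_left hℓ hXY he).symm)
    (h₂.congr fun e he => (mem_glue_edges_right hℓ hXY he).symm) ?_
  by_cases hb : b
  · left
    intro e he hec h1 h2
    exact mem_glue_edges.2 ⟨⟨he, hec⟩, Or.inr (Or.inr
      ⟨not_subset_of_inter_nonempty hXY h2, not_subset_of_inter_nonempty hXY.symm h1, hb⟩)⟩
  · right
    intro e he hec h1 h2 hm
    rcases (mem_glue_edges.1 hm).2 with k | k | k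
    · exact not_subset_of_inter_nonempty hXY h2 k.1
    · exact not_subset_of_inter_nonempty hXY.symm h1 k.1
    · exact hb k.2.2

end glue

end UniformHypergraph

theorem choose_add_choose_le (x y k : ℕ) :
    x.choose (k + 1) + y.choose (k + 1) ≤ (x + y).choose (k + 1) := by
  induction y with
  | zero => simp
  | succ y ih =>
    rw [← add_assoc, Nat.choose_succ_succ y, Nat.choose_succ_succ (x + y)]
    have := Nat.choose_le_choose k (show y ≤ x + y by omega)
    simp only [Nat.succ_eq_add_one]
    omega

/-- On `W`, the cohypergraph `H` differs from `E` only in sets of the family `B`, of bounded size,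
and in sets containing a member of the family `Q` of at most `β` sets of size `k`. -/
structure IsApproximation (E : Finset V → Prop) {ℓ : ℕ} (m k β : ℕ) (W : Finset V)
    (H : UniformHypergraph V ℓ) (B Q : Finset (Finset V)) : Prop where
  isCohypergraphOn : H.IsCohypergraphOn W
  card_eq_of_mem_bad : ∀ e ∈ B, #e = ℓ
  card_bad_le : m * #B ≤ (2 ^ ℓ + ℓ) * (#W + m) * (#W).choose (ℓ - 1)
  card_eq_of_mem : ∀ q ∈ Q, #q = k
  card_le : #Q ≤ β
  mem_or_exists : ∀ e ⊆ W, #e = ℓ → ¬ (e ∈ H.edges ↔ E e) → e ∈ B ∨ ∃ q ∈ Q, q ⊆ e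

/-- The summand `m` in `#W + m` pays for the accounting. The new crossing errors cost a multiple of
`m` times the gain in `(#W).choose (ℓ - 1)`, which cancels the `m` term of `X`. Since `m ≤ #X`, the
factor `#Y + m` is at most `#X + #Y`, and superadditivity of the binomial absorbs the rest. -/
theorem IsApproximation.glue {E F : Finset V → Prop} {ℓ m k β₁ β₂ : ℕ} (hℓ : 2 ≤ ℓ)
    {X Y : Finset V} {H₁ H₂ : UniformHypergraph V ℓ} {B₁ B₂ Q₁ Q₂ : Finset (Finset V)} {b : Prop}
    (h₁ : IsApproximation E m k β₁ X H₁ B₁ Q₁) (h₂ : IsApproximation E m k β₂ Y H₂ B₂ Q₂)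
    (hX : X.Nonempty) (hY : Y.Nonempty) (hXY : Disjoint X Y) (hm : m ≤ #X)
    (hF : ∀ e, ¬ (b ↔ E e) → F e)
    (hcross : #(crossing F ℓ X Y) + (2 ^ ℓ + ℓ) * (#X).choose (ℓ - 1) ≤
      (2 ^ ℓ + ℓ) * (#(X ∪ Y)).choose (ℓ - 1)) :
    IsApproximation E m k (β₁ + β₂) (X ∪ Y) (UniformHypergraph.glue H₁ H₂ X Y b)
      (B₁ ∪ B₂ ∪ crossing F ℓ X Y) (Q₁ ∪ Q₂) where
  isCohypergraphOn := UniformHypergraph.isCohypergraphOn_glue (by omega) hX hY hXY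
    h₁.isCohypergraphOn h₂.isCohypergraphOn
  card_eq_of_mem_bad := by
    intro e he
    simp only [mem_union] at he
    rcases he with (he | he) | he
    · exact h₁.card_eq_of_mem_bad e he
    · exact h₂.card_eq_of_mem_bad e he
    · exact (mem_powersetCard.1 (mem_filter.1 he).1).2
  card_bad_le := by
    have c1 := h₁.card_bad_le
    have c2 := h₂.card_bad_le
    have hu : #(B₁ ∪ B₂ ∪ crossing F ℓ X Y) ≤ #B₁ + #B₂ + #(crossing F ℓ X Y) :=
      (card_union_le _ _).trans (Nat.add_le_add_right (card_union_le _ _) _)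
    have hw := card_union_of_disjoint hXY
    have hch : (#X).choose (ℓ - 1) + (#Y).choose (ℓ - 1) ≤ (#(X ∪ Y)).choose (ℓ - 1) := by
      obtain ⟨j, hj⟩ : ∃ j, ℓ - 1 = j + 1 := ⟨ℓ - 2, by omega⟩
      rw [hj, hw]
      exact choose_add_choose_le _ _ _
    generalize 2 ^ ℓ + ℓ = c at *
    generalize (#X).choose (ℓ - 1) = p at *
    generalize (#Y).choose (ℓ - 1) = q at *
    generalize (#(X ∪ Y)).choose (ℓ - 1) = r at *
    have e1 := Nat.mul_le_mul_left m hu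
    have e2 := Nat.mul_le_mul_left m hcross
    have e3 := Nat.mul_le_mul_left (c * (#X + #Y)) hch
    have e4 : c * (#Y + m) * q ≤ c * (#X + #Y) * q :=
      Nat.mul_le_mul_right _ (Nat.mul_le_mul_left _ (by omega))
    rw [hw]
    nlinarith [e1, e2, e3, e4, c1, c2, Nat.zero_le (c * #Y * p)]
  card_eq_of_mem := by
    intro q hq
    exact (mem_union.1 hq).elim (h₁.card_eq_of_mem q) (h₂.card_eq_of_mem q)
  card_le := (card_union_le _ _).trans (add_le_add h₁.card_le h₂.card_le)
  mem_or_exists := by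
    intro e he hec hne
    by_cases heX : e ⊆ X
    · rw [UniformHypergraph.mem_glue_edges_left (by omega) hXY heX] at hne
      rcases h₁.mem_or_exists e heX hec hne with k | ⟨q, hq, hqe⟩
      · exact Or.inl (by simp [k])
      · exact Or.inr ⟨q, mem_union_left _ hq, hqe⟩
    by_cases heY : e ⊆ Y
    · rw [UniformHypergraph.mem_glue_edges_right (by omega) hXY heY] at hne
      rcases h₂.mem_or_exists e heY hec hne with k | ⟨q, hq, hqe⟩
      · exact Or.inl (by simp [k])
      · exact Or.inr ⟨q, mem_union_right _ hq, hqe⟩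
    · have : e ∈ (UniformHypergraph.glue H₁ H₂ X Y b).edges ↔ b := by
        rw [UniformHypergraph.mem_glue_edges]
        tauto
      rw [this] at hne
      refine Or.inl (mem_union_right _ ?_)
      simp only [crossing, mem_filter, mem_powersetCard]
      exact ⟨⟨he, hec⟩, hF e hne, UniformHypergraph.inter_nonempty_of_not_subset
        (by rwa [union_comm]) heY, UniformHypergraph.inter_nonempty_of_not_subset he heX⟩

/-- A disperse hypergraph decomposes along sparse and co-sparse cuts into pieces which are small or
have small degrees or codegrees; hence it is approximated by a cohypergraph as soon as these pieces
are. -/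
theorem DispersePred.exists_isApproximation {E : Finset V → Prop} {ℓ m k : ℕ} {β : ℕ → ℕ}
    (h : DispersePred E ℓ) (hℓ : 3 ≤ ℓ) (hm : 1 ≤ m) (hβ : ∀ x y, β x + β y ≤ β (x + y))
    (hpiece : ∀ L : Finset V, L.Nonempty → (#L < 2 * m + ℓ ∨
      (∀ R ⊆ L, #R = ℓ - 1 → HasSmallDegree E m L R) ∨
      (∀ R ⊆ L, #R = ℓ - 1 → HasSmallDegree (fun e => ¬ E e) m L R)) →
      ∃ (H : UniformHypergraph V ℓ) (Q : Finset (Finset V)),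
        IsApproximation E m k (β #L) L H ∅ Q) (W : Finset V) :
    W.Nonempty → ∃ (H : UniformHypergraph V ℓ) (B Q : Finset (Finset V)),
      IsApproximation E m k (β #W) W H B Q := by
  induction W using Finset.strongInduction with
  | H W ih =>
    intro hW
    have hcut : ∀ (b : Prop) (F : Finset V → Prop), (∀ e, ¬ (b ↔ E e) → F e) →
        HasSparseCut F ℓ m W → ∃ (H : UniformHypergraph V ℓ) (B Q : Finset (Finset V)),
        IsApproximation E m k (β #W) W H B Q := by
      rintro b F hF ⟨X, Y, hX, hY, hXY, rfl, hmX, hcr⟩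
      have hXs : X ⊂ X ∪ Y := by
        refine ⟨subset_union_left, fun hh => ?_⟩
        obtain ⟨y, hy⟩ := hY
        exact disjoint_left.1 hXY (hh (mem_union_right _ hy)) hy
      have hYs : Y ⊂ X ∪ Y := by
        refine ⟨subset_union_right, fun hh => ?_⟩
        obtain ⟨x, hx⟩ := hX
        exact disjoint_left.1 hXY hx (hh (mem_union_left _ hx))
      obtain ⟨H₁, B₁, Q₁, h₁⟩ := ih X hXs hX
      obtain ⟨H₂, B₂, Q₂, h₂⟩ := ih Y hYs hY
      have hg := h₁.glue (b := b) (by omega) h₂ hX hY hXY hmX hF hcr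
      refine ⟨_, _, _, { hg with card_le := hg.card_le.trans ?_ }⟩
      rw [card_union_of_disjoint hXY]
      exact hβ _ _
    have hleaf := hpiece W hW
    by_cases hsmall : #W < 2 * m + ℓ
    · obtain ⟨H, Q, hHQ⟩ := hleaf (Or.inl hsmall)
      exact ⟨H, ∅, Q, hHQ⟩
    rcases h.uniform_or_hasSparseCut hℓ hm (not_lt.1 hsmall) with hh | hh | hh | hh
    · obtain ⟨H, Q, hHQ⟩ := hleaf (Or.inr (Or.inl hh))
      exact ⟨H, ∅, Q, hHQ⟩
    · obtain ⟨H, Q, hHQ⟩ := hleaf (Or.inr (Or.inr hh))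
      exact ⟨H, ∅, Q, hHQ⟩
    · exact hcut False E (fun e he => by tauto) hh
    · exact hcut True _ (fun e he => by tauto) hh

end Approximation

/-! ### Cliques and independent sets in cohypergraphs and in pieces of small degree; the deletion
method. -/

section Parts

open scoped Classical

variable {V : Type*} [DecidableEq V]

namespace UniformHypergraph

/-- Two edges and two non-edges among the `ℓ + 1` subsets would put the edge count between `2` and
`ℓ - 1`. -/
theorem IsDisperse.dispersePred {ℓ : ℕ} {G : UniformHypergraph V ℓ} (h : G.IsDisperse) :
    DispersePred (fun e => e ∈ G.edges) ℓ := by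
  intro X hX e₁ e₂ f₁ f₂ he1 he2 hf1 hf2 ce1 ce2 cf1 cf2 hne hnf E1 E2 F1 F2
  have hlow : 2 ≤ G.edgesIn X := by
    rw [edgesIn, ← card_pair hne]
    refine card_le_card ?_
    intro e he
    simp only [mem_insert, mem_singleton] at he
    rcases he with rfl | rfl
    · exact mem_filter.2 ⟨E1, he1⟩
    · exact mem_filter.2 ⟨E2, he2⟩
  have hup : G.edgesIn X + 2 ≤ ℓ + 1 := by
    have hd : Disjoint {e ∈ G.edges | e ⊆ X} {f₁, f₂} := by
      rw [disjoint_right]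
      intro e he he'
      simp only [mem_insert, mem_singleton] at he
      rcases he with rfl | rfl
      · exact F1 (mem_filter.1 he').1
      · exact F2 (mem_filter.1 he').1
    have hsub : {e ∈ G.edges | e ⊆ X} ∪ {f₁, f₂} ⊆ powersetCard ℓ X := by
      intro e he
      rw [mem_powersetCard]
      simp only [mem_union, mem_filter, mem_insert, mem_singleton] at he
      rcases he with he | rfl | rfl
      · exact ⟨he.2, G.card_of_mem e he.1⟩
      · exact ⟨hf1, cf1⟩
      · exact ⟨hf2, cf2⟩
    have := card_le_card hsub
    rwa [card_union_of_disjoint hd, card_pair hnf, card_powersetCard, hX,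
      Nat.choose_succ_self_right] at this
  rcases h X hX with k | k | k | k <;> omega

theorem isCohypergraphOn_of_forall {ℓ : ℕ} {G : UniformHypergraph V ℓ} {b : Prop} (W : Finset V)
    (hW : W.Nonempty) (h : ∀ e ⊆ W, #e = ℓ → (e ∈ G.edges ↔ b)) : G.IsCohypergraphOn W := by
  induction W using Finset.induction_on with
  | empty => simp at hW
  | insert v W hv ih =>
    rcases W.eq_empty_or_nonempty with rfl | hW'
    · exact .single v
    · refine .join {v} W (by simp) hW' (by simpa using hv) (.single v)
        (ih hW' fun e he => h e (he.trans (subset_insert _ _))) ?_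
      by_cases hb : b
      · exact Or.inl fun e he hec _ _ => (h e he hec).2 hb
      · exact Or.inr fun e he hec _ _ k => hb ((h e he hec).1 k)

/-- The complete (if `b` holds) or empty hypergraph on the vertex set `W`. -/
noncomputable def const {V : Type*} (ℓ : ℕ) (W : Finset V) (b : Prop) : UniformHypergraph V ℓ where
  edges := {_e ∈ powersetCard ℓ W | b}
  card_of_mem := fun _ he => (mem_powersetCard.1 (mem_filter.1 he).1).2

theorem mem_const_edges {V : Type*} {ℓ : ℕ} {W e : Finset V} {b : Prop} (he : e ⊆ W)
    (hec : #e = ℓ) : e ∈ (const ℓ W b).edges ↔ b := by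
  rw [const, mem_filter, mem_powersetCard]
  exact ⟨fun k => k.2, fun k => ⟨⟨he, hec⟩, k⟩⟩

/-- A set of vertices of a cohypergraph contains a clique and an independent set the product of
whose sizes is at least the size of the set. -/
theorem IsCohypergraphOn.exists_clique_independent {ℓ : ℕ} (hℓ : 2 ≤ ℓ)
    {G : UniformHypergraph V ℓ} {W : Finset V} (hG : G.IsCohypergraphOn W) :
    ∀ Z ⊆ W, ∃ C ⊆ Z, ∃ I ⊆ Z, G.IsClique C ∧ G.IsIndependent I ∧ #Z ≤ #C * #I := by
  induction hG with
  | single v =>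
    intro Z hZ
    have hZ1 : #Z ≤ 1 := by simpa using card_le_card hZ
    refine ⟨Z, Subset.rfl, Z, Subset.rfl, ?_, ?_, ?_⟩
    · intro e he hec
      have := card_le_card he
      omega
    · intro e he heE
      have := card_le_card he
      have := G.card_of_mem e heE
      omega
    · interval_cases #Z <;> simp
  | join X Y hX hY hXY hGX hGY hc ihX ihY =>
    intro Z hZ
    obtain ⟨C₁, hC₁, I₁, hI₁, hc₁, hi₁, h₁⟩ := ihX (Z ∩ X) inter_subset_right
    obtain ⟨C₂, hC₂, I₂, hI₂, hc₂, hi₂, h₂⟩ := ihY (Z ∩ Y) inter_subset_right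
    have hZc : #Z = #(Z ∩ X) + #(Z ∩ Y) := by
      rw [← card_union_of_disjoint (hXY.mono inter_subset_right inter_subset_right),
        ← inter_union_distrib_left, inter_eq_left.2 hZ]
    have hsX : ∀ {C : Finset V}, C ⊆ Z ∩ X → C ⊆ X := fun h => h.trans inter_subset_right
    have hsY : ∀ {C : Finset V}, C ⊆ Z ∩ Y → C ⊆ Y := fun h => h.trans inter_subset_right
    have hsZ : ∀ {C D : Finset V}, C ⊆ Z ∩ X → D ⊆ Z ∩ Y → C ∪ D ⊆ Z := fun h h' =>
      union_subset (h.trans inter_subset_left) (h'.trans inter_subset_left)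
    have hdis : ∀ {C D : Finset V}, C ⊆ Z ∩ X → D ⊆ Z ∩ Y → #(C ∪ D) = #C + #D := fun h h' =>
      card_union_of_disjoint (hXY.mono (hsX h) (hsY h'))
    have hsub : ∀ {C D e : Finset V}, C ⊆ Z ∩ X → D ⊆ Z ∩ Y → e ⊆ C ∪ D →
        e ⊆ C ∨ e ⊆ D ∨ (e ⊆ X ∪ Y ∧ (e ∩ X).Nonempty ∧ (e ∩ Y).Nonempty) := by
      intro C D e hC hD he
      by_cases h1 : e ⊆ C
      · exact Or.inl h1
      by_cases h2 : e ⊆ D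
      · exact Or.inr (Or.inl h2)
      refine Or.inr (Or.inr ⟨he.trans (union_subset_union (hsX hC) (hsY hD)), ?_, ?_⟩)
      · exact (inter_nonempty_of_not_subset (by rwa [union_comm]) h2).mono
          (inter_subset_inter_left (hsX hC))
      · exact (inter_nonempty_of_not_subset he h1).mono (inter_subset_inter_left (hsY hD))
    rcases hc with hc | hc
    · have hcl : G.IsClique (C₁ ∪ C₂) := by
        intro e he hec
        rcases hsub hC₁ hC₂ he with k | k | k
        · exact hc₁ e k hec
        · exact hc₂ e k hec
        · exact hc e k.1 hec k.2.1 k.2.2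
      -- When all crossing sets are edges, cliques add up and only the larger independent set is
      -- kept: `#C₁ * #I₁ + #C₂ * #I₂` is at most `(#C₁ + #C₂)` times the maximum.
      rcases le_total (#I₁) (#I₂) with hle | hle
      · refine ⟨_, hsZ hC₁ hC₂, I₂, hI₂.trans inter_subset_left, hcl, hi₂, ?_⟩
        rw [hdis hC₁ hC₂]
        nlinarith
      · refine ⟨_, hsZ hC₁ hC₂, I₁, hI₁.trans inter_subset_left, hcl, hi₁, ?_⟩
        rw [hdis hC₁ hC₂]
        nlinarith
    · have hin : G.IsIndependent (I₁ ∪ I₂) := by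
        intro e he heE
        rcases hsub hI₁ hI₂ he with k | k | k
        · exact hi₁ e k heE
        · exact hi₂ e k heE
        · exact hc e k.1 (G.card_of_mem e heE) k.2.1 k.2.2 heE
      rcases le_total (#C₁) (#C₂) with hle | hle
      · refine ⟨C₂, hC₂.trans inter_subset_left, _, hsZ hI₁ hI₂, hc₂, hin, ?_⟩
        rw [hdis hI₁ hI₂]
        nlinarith
      · refine ⟨C₁, hC₁.trans inter_subset_left, _, hsZ hI₁ hI₂, hc₁, hin, ?_⟩
        rw [hdis hI₁ hI₂]
        nlinarith

end UniformHypergraph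

theorem card_filter_le_of_degree_le {F : Finset V → Prop} {ℓ D : ℕ} (hℓ : 1 ≤ ℓ) {L : Finset V}
    (h : ∀ R ⊆ L, #R = ℓ - 1 → #{x ∈ L \ R | F (insert x R)} ≤ D) :
    #{e ∈ powersetCard ℓ L | F e} ≤ (#L).choose (ℓ - 1) * D := by
  have hsub : {e ∈ powersetCard ℓ L | F e} ⊆ (powersetCard (ℓ - 1) L).biUnion
      fun R => ({x ∈ L \ R | F (insert x R)}).image fun x => insert x R := by
    intro e he
    rw [mem_filter, mem_powersetCard] at he
    obtain ⟨⟨heL, hec⟩, heF⟩ := he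
    obtain ⟨x, hx⟩ : e.Nonempty := by rw [← card_pos]; omega
    rw [mem_biUnion]
    refine ⟨e.erase x, ?_, mem_image.2 ⟨x, ?_, insert_erase hx⟩⟩
    · rw [mem_powersetCard, card_erase_of_mem hx, hec]
      exact ⟨(erase_subset _ _).trans heL, rfl⟩
    · rw [mem_filter, mem_sdiff, insert_erase hx]
      exact ⟨⟨heL hx, notMem_erase _ _⟩, heF⟩
  rw [← card_powersetCard]
  refine (card_le_card hsub).trans (card_biUnion_le_card_mul _ _ _ ?_)
  intro R hR
  rw [mem_powersetCard] at hR
  exact card_image_le.trans (h R hR.1 hR.2)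

/-- Take `I` of maximum size. Each vertex outside `I` completes an edge with some `(ℓ - 1)`-subset
of `I`, and each such subset accounts for fewer than `m` vertices. -/
theorem exists_independent_of_smallDegree {E : Finset V → Prop} {ℓ m : ℕ} (hℓ : 1 ≤ ℓ)
    {L : Finset V} (h : ∀ R ⊆ L, #R = ℓ - 1 → HasSmallDegree E m L R) :
    ∃ I ⊆ L, (∀ e ⊆ I, #e = ℓ → ¬ E e) ∧ #L ≤ #I + #I ^ (ℓ - 1) * m := by
  have hne : ({I ∈ L.powerset | ∀ e ⊆ I, #e = ℓ → ¬ E e}).Nonempty := by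
    refine ⟨∅, ?_⟩
    simp only [mem_filter, mem_powerset, empty_subset, true_and]
    intro e he hec
    rw [subset_empty.1 he, card_empty] at hec
    omega
  obtain ⟨I, hI, hmax⟩ := exists_max_image _ card hne
  rw [mem_filter, mem_powerset] at hI
  refine ⟨I, hI.1, hI.2, ?_⟩
  have hsub : L \ I ⊆ (powersetCard (ℓ - 1) I).biUnion fun R => {x ∈ L \ R | E (insert x R)} := by
    intro x hx
    rw [mem_sdiff] at hx
    obtain ⟨e, he, hec, hEe⟩ : ∃ e ⊆ insert x I, #e = ℓ ∧ E e := by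
      by_contra hcon
      push Not at hcon
      have := hmax (insert x I) (by
        rw [mem_filter, mem_powerset]
        exact ⟨insert_subset hx.1 hI.1, hcon⟩)
      rw [card_insert_of_notMem hx.2] at this
      omega
    have hxe : x ∈ e := by
      by_contra hxe
      exact hI.2 e ((subset_insert_iff_of_notMem hxe).1 he) hec hEe
    rw [mem_biUnion]
    refine ⟨e.erase x, ?_, ?_⟩
    · rw [mem_powersetCard, card_erase_of_mem hxe, hec]
      exact ⟨subset_insert_iff.1 he, rfl⟩
    · rw [mem_filter, mem_sdiff, insert_erase hxe]
      exact ⟨⟨hx.1, notMem_erase _ _⟩, hEe⟩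
  have h1 := (card_le_card hsub).trans (card_biUnion_le_card_mul _ _ m (by
    intro R hR
    rw [mem_powersetCard] at hR
    exact (h R (hR.1.trans hI.1) hR.2).le))
  rw [card_powersetCard, card_sdiff_of_subset hI.1] at h1
  have h2 := Nat.mul_le_mul_right m (Nat.choose_le_pow (#I) (ℓ - 1))
  omega

section Deletion

variable [Fintype V]

/-- This is the probability that a `p`-random set contains `e`. Expand the product over all vertices
of `p + (1 - p)`, with `1 - p` replaced by `0` on `e`. -/
theorem sum_weight_filter_subset (p : ℝ) (e : Finset V) :
    ∑ Z : Finset V, (p ^ #Z * (1 - p) ^ #(univ \ Z)) * (if e ⊆ Z then 1 else 0) = p ^ #e := by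
  have h := prod_add (fun _ : V => p) (fun v => if v ∈ e then 0 else 1 - p) univ
  have h1 : ∏ v : V, (p + if v ∈ e then 0 else 1 - p) = p ^ #e := by
    have : ∀ v : V, (p + if v ∈ e then 0 else 1 - p) = if v ∈ e then p else 1 := by
      intro v; split_ifs <;> ring
    simp only [this]
    rw [prod_ite_mem, univ_inter, prod_const]
  rw [h1, powerset_univ] at h
  rw [h]
  refine sum_congr rfl fun Z _ => ?_
  rw [prod_const, mul_assoc]
  congr 1
  by_cases he : e ⊆ Z
  · rw [if_pos he, mul_one, ← prod_const]
    refine prod_congr rfl fun v hv => ?_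
    rw [if_neg fun k => (mem_sdiff.1 hv).2 (he k)]
  · obtain ⟨v, hv, hvZ⟩ := not_subset.1 he
    rw [if_neg he, mul_zero]
    refine (prod_eq_zero (i := v) ?_ ?_).symm
    · exact mem_sdiff.2 ⟨mem_univ v, hvZ⟩
    · exact if_pos hv

/-- The deletion method: a family of nonempty sets admits an independent set which is at least as
large as the expected size of a `p`-random set minus the expected number of members in it. -/
theorem exists_independent_of_deletion {p : ℝ} (hp0 : 0 ≤ p) (hp1 : p ≤ 1)
    (𝓕 : Finset (Finset V)) (h𝓕 : ∀ e ∈ 𝓕, e.Nonempty) :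
    ∃ Z : Finset V, (∀ e ∈ 𝓕, ¬ e ⊆ Z) ∧
      p * Fintype.card V - ∑ e ∈ 𝓕, p ^ #e ≤ #Z := by
  set w : Finset V → ℝ := fun Z => p ^ #Z * (1 - p) ^ #(univ \ Z) with hw
  have hw0 : ∀ Z, 0 ≤ w Z := fun Z =>
    mul_nonneg (pow_nonneg hp0 _) (pow_nonneg (by linarith) _)
  have hsum1 : ∑ Z, w Z = 1 := by
    have := sum_weight_filter_subset p (∅ : Finset V)
    simpa using this
  have hsumE : ∀ 𝓖 : Finset (Finset V),
      ∑ Z, w Z * (#{e ∈ 𝓖 | e ⊆ Z} : ℝ) = ∑ e ∈ 𝓖, p ^ #e := by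
    intro 𝓖
    simp only [card_filter, Nat.cast_sum, mul_sum]
    rw [sum_comm]
    refine sum_congr rfl fun e _ => ?_
    rw [← sum_weight_filter_subset p e]
    refine sum_congr rfl fun Z _ => ?_
    push_cast
    rfl
  have hsumV : ∑ Z, w Z * (#Z : ℝ) = p * Fintype.card V := by
    have := hsumE (univ.image fun v : V => {v})
    rw [sum_image fun a _ b _ hab => singleton_injective hab] at this
    simp only [card_singleton, pow_one, sum_const, nsmul_eq_mul, card_univ] at this
    rw [mul_comm, ← this]
    refine sum_congr rfl fun Z _ => ?_
    congr 2
    rw [← card_image_of_injective Z (singleton_injective (α := V))]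
    congr 1
    ext e
    simp only [mem_image, mem_filter, mem_univ, true_and]
    constructor
    · rintro ⟨v, hv, rfl⟩
      exact ⟨⟨v, rfl⟩, by simpa using hv⟩
    · rintro ⟨⟨v, rfl⟩, hv⟩
      exact ⟨v, by simpa using hv, rfl⟩
  obtain ⟨Z, hZ⟩ : ∃ Z : Finset V, p * Fintype.card V - ∑ e ∈ 𝓕, p ^ #e ≤
      (#Z : ℝ) - #{e ∈ 𝓕 | e ⊆ Z} := by
    by_contra hcon
    push Not at hcon
    set c := p * Fintype.card V - ∑ e ∈ 𝓕, p ^ #e with hc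
    -- If every `Z` fell short of the expectation `c`, a sum of nonnegative terms would vanish
    -- although some `Z` has positive weight.
    have hmean : ∑ Z, w Z * (c - ((#Z : ℝ) - #{e ∈ 𝓕 | e ⊆ Z})) = 0 := by
      simp only [mul_sub, sum_sub_distrib, ← sum_mul, hsum1, hsumV, hsumE]
      rw [hc]; ring
    obtain ⟨Z, _, hZ⟩ : ∃ Z ∈ (univ : Finset (Finset V)), 0 < w Z := by
      by_contra hz
      push Not at hz
      have := sum_nonpos hz
      linarith
    have := (sum_eq_zero_iff_of_nonneg fun Z _ =>
      mul_nonneg (hw0 Z) (sub_nonneg.2 (hcon Z).le)).1 hmean Z (mem_univ _)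
    have := mul_pos hZ (sub_pos.2 (hcon Z))
    linarith
  choose f hf using h𝓕
  set D := ({e ∈ 𝓕 | e ⊆ Z}).attach.image fun e => f e.1 (mem_filter.1 e.2).1 with hD
  refine ⟨Z \ D, ?_, ?_⟩
  · intro e he heZ
    have heZ' := heZ.trans sdiff_subset
    have := (mem_sdiff.1 (heZ (hf e he))).2
    have hm : e ∈ {e ∈ 𝓕 | e ⊆ Z} := mem_filter.2 ⟨he, heZ'⟩
    exact this (mem_image.2 ⟨⟨e, hm⟩, mem_attach _ _, rfl⟩)
  · have h1 : #Z ≤ #(Z \ D) + #{e ∈ 𝓕 | e ⊆ Z} := by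
      have := le_card_sdiff D Z
      have h2 : #D ≤ #{e ∈ 𝓕 | e ⊆ Z} :=
        card_image_le.trans card_attach.le
      omega
    have h2 : (#Z : ℝ) ≤ #(Z \ D) + #{e ∈ 𝓕 | e ⊆ Z} := by exact_mod_cast h1
    linarith

end Deletion

end Parts

/-! ### Choice of parameters and the two conclusions. -/

section Main

open scoped Classical

variable {V : Type*} [DecidableEq V]

theorem hasSmallDegree_of_card_lt {F : Finset V → Prop} {D : ℕ} {L R : Finset V} (h : #L < D) :
    HasSmallDegree F D L R :=
  ((card_filter_le _ _).trans (card_le_card sdiff_subset)).trans_lt h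

theorem HasSmallDegree.mono {F : Finset V → Prop} {m D : ℕ} {L R : Finset V}
    (h : HasSmallDegree F m L R) (hD : m ≤ D) : HasSmallDegree F D L R :=
  Nat.lt_of_lt_of_le h hD

namespace UniformHypergraph

theorem isApproximation_const {E F : Finset V → Prop} {ℓ m D : ℕ} (hℓ : 1 ≤ ℓ) {L : Finset V}
    (hL : L.Nonempty) (b : Prop) (hF : ∀ e, ¬ (b ↔ E e) → F e)
    (h : ∀ R ⊆ L, #R = ℓ - 1 → HasSmallDegree F D L R) :
    IsApproximation E m ℓ ((#L).choose (ℓ - 1) * D) L (const ℓ L b) ∅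
      {e ∈ powersetCard ℓ L | F e} where
  isCohypergraphOn := isCohypergraphOn_of_forall L hL fun _ he hec => mem_const_edges he hec
  card_eq_of_mem_bad := by simp
  card_bad_le := by simp
  card_eq_of_mem := fun q hq => (mem_powersetCard.1 (mem_filter.1 hq).1).2
  card_le := card_filter_le_of_degree_le hℓ fun R hR hRc => (h R hR hRc).le
  mem_or_exists := by
    intro e he hec hne
    rw [mem_const_edges he hec] at hne
    exact Or.inr ⟨e, mem_filter.2 ⟨mem_powersetCard.2 ⟨he, hec⟩, hF e hne⟩, Subset.rfl⟩

/-- A disperse hypergraph is close to a cohypergraph. -/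
theorem IsDisperse.exists_isCohypergraph [Fintype V] [Nonempty V] {ℓ : ℕ} (hℓ : 3 ≤ ℓ)
    {G : UniformHypergraph V ℓ} (hG : G.IsDisperse) :
    ∃ H : UniformHypergraph V ℓ, H.IsCohypergraph ∧
      (#(G.edges ∆ H.edges) : ℝ) ≤
        (3 * (2 ^ ℓ + ℓ) + (4 + ℓ)) * (Fintype.card V : ℝ) ^ ((ℓ : ℝ) - 1 / 2) := by
  set n := Fintype.card V with hn
  have hn1 : 1 ≤ n := Fintype.card_pos
  -- Crossing errors are of order `n ^ ℓ / m` and errors inside pieces of order `m * n ^ (ℓ - 1)`;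
  -- `m` near `√n` balances them. The common degree bound `2 * m + ℓ` also covers the pieces of size
  -- below `2 * m + ℓ`.
  set m := Nat.sqrt n + 1 with hm
  have hβ : ∀ x y : ℕ, x.choose (ℓ - 1) * (2 * m + ℓ) + y.choose (ℓ - 1) * (2 * m + ℓ) ≤
      (x + y).choose (ℓ - 1) * (2 * m + ℓ) := by
    intro x y
    rw [← add_mul]
    obtain ⟨j, hj⟩ : ∃ j, ℓ - 1 = j + 1 := ⟨ℓ - 2, by omega⟩
    rw [hj]
    exact Nat.mul_le_mul_right _ (choose_add_choose_le x y j)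
  obtain ⟨H, B, Q, hH⟩ := hG.dispersePred.exists_isApproximation (m := m) (k := ℓ)
    (β := fun x => x.choose (ℓ - 1) * (2 * m + ℓ)) hℓ (by omega) hβ (by
      intro L hL hh
      rcases hh with hh | hh | hh
      · exact ⟨_, _, isApproximation_const (D := 2 * m + ℓ) (by omega) hL False
          (F := fun e => e ∈ G.edges) (fun e he => by tauto)
          fun R _ _ => hasSmallDegree_of_card_lt hh⟩
      · exact ⟨_, _, isApproximation_const (D := 2 * m + ℓ) (by omega) hL False (fun e he => by tauto)
          fun R hR hRc => (hh R hR hRc).mono (by omega)⟩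
      · exact ⟨_, _, isApproximation_const (D := 2 * m + ℓ) (by omega) hL True (fun e he => by tauto)
          fun R hR hRc => (hh R hR hRc).mono (by omega)⟩) univ univ_nonempty
  refine ⟨H, hH.isCohypergraphOn, ?_⟩
  have hsub : G.edges ∆ H.edges ⊆ B ∪ Q := by
    intro e he
    rw [mem_symmDiff] at he
    have hec : #e = ℓ := he.elim (fun k => G.card_of_mem e k.1) fun k => H.card_of_mem e k.1
    rcases hH.mem_or_exists e (subset_univ e) hec (by tauto) with k | ⟨q, hq, hqe⟩
    · exact mem_union_left _ k
    · have hqc := hH.card_eq_of_mem q hq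
      rw [← eq_of_subset_of_card_le hqe (by omega)]
      exact mem_union_right _ hq
  have hcard : (#(G.edges ∆ H.edges) : ℝ) ≤ #B + #Q := by
    exact_mod_cast (card_le_card hsub).trans (card_union_le _ _)
  have hB := hH.card_bad_le
  have hQ := hH.card_le
  rw [card_univ, ← hn] at hB hQ
  set x : ℝ := Real.sqrt n with hx
  have hn1' : (1 : ℝ) ≤ n := by exact_mod_cast hn1
  have hx1 : 1 ≤ x := Real.one_le_sqrt.2 hn1'
  have hxx : x * x = n := Real.mul_self_sqrt (by positivity)
  have hxm : x ≤ m := by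
    rw [hm]; push_cast; exact Real.real_sqrt_le_nat_sqrt_succ
  have hmx : (m : ℝ) ≤ 2 * x := by
    have : (Nat.sqrt n : ℝ) ≤ x := Real.nat_sqrt_le_real_sqrt
    rw [hm]; push_cast; linarith
  set P : ℝ := (n : ℝ) ^ (ℓ - 1) with hP
  have hP0 : 0 ≤ P := by positivity
  have hpow : (n : ℝ) ^ ((ℓ : ℝ) - 1 / 2) = x * P := by
    have : (ℓ : ℝ) - 1 / 2 = 1 / 2 + ((ℓ - 1 : ℕ) : ℝ) := by
      rw [Nat.cast_sub (by omega)]; push_cast; ring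
    rw [this, Real.rpow_add (by linarith), Real.rpow_natCast, ← Real.sqrt_eq_rpow]
  have hch : ((n.choose (ℓ - 1) : ℕ) : ℝ) ≤ P := by
    rw [hP]; exact_mod_cast Nat.choose_le_pow n (ℓ - 1)
  have hBr : (m : ℝ) * #B ≤ (2 ^ ℓ + ℓ) * (n + m) * (n.choose (ℓ - 1) : ℕ) := by
    exact_mod_cast hB
  have hQr : (#Q : ℝ) ≤ (n.choose (ℓ - 1) : ℕ) * (2 * m + ℓ) := by exact_mod_cast hQ
  set c : ℝ := 2 ^ ℓ + ℓ with hc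
  have hc0 : 0 ≤ c := by positivity
  have hB' : (#B : ℝ) ≤ 3 * c * (x * P) := by
    have h1 : x * #B ≤ m * #B := mul_le_mul_of_nonneg_right hxm (by positivity)
    have h2 : c * (n + m) * (n.choose (ℓ - 1) : ℕ) ≤ c * (3 * (x * x)) * P := by
      refine mul_le_mul (mul_le_mul_of_nonneg_left ?_ hc0) hch (by positivity) (by positivity)
      nlinarith
    have h3 : x * #B ≤ x * (3 * c * (x * P)) := by
      calc x * #B ≤ c * (3 * (x * x)) * P := (h1.trans hBr).trans h2
        _ = _ := by ring
    exact le_of_mul_le_mul_left h3 (by linarith)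
  have hQ' : (#Q : ℝ) ≤ (4 + ℓ) * (x * P) := by
    calc (#Q : ℝ) ≤ P * (2 * m + ℓ) :=
          hQr.trans (mul_le_mul_of_nonneg_right hch (by positivity))
      _ ≤ P * ((4 + ℓ) * x) := by
          refine mul_le_mul_of_nonneg_left ?_ hP0
          nlinarith [(Nat.cast_nonneg ℓ : (0 : ℝ) ≤ ℓ)]
      _ = _ := by ring
  rw [hpow]
  linarith

theorem IsIndependent.card_le {V : Type*} [Fintype V] {ℓ : ℕ} {G : UniformHypergraph V ℓ} {I : Finset V}
    (hI : G.IsIndependent I) : #I ≤ G.independenceNumber :=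
  le_sup (f := card) (mem_filter.2 ⟨mem_univ I, hI⟩)

theorem IsClique.card_le {V : Type*} [Fintype V] {ℓ : ℕ} {G : UniformHypergraph V ℓ} {C : Finset V}
    (hC : G.IsClique C) : #C ≤ G.cliqueNumber :=
  le_sup (f := card) (mem_filter.2 ⟨mem_univ C, hC⟩)

/-- If all pieces of the decomposition with threshold `m` have size at most `K`, then the clique and
independence numbers can be bounded below by the deletion method. -/
theorem IsDisperse.le_sq_of_forall_piece_le [Fintype V] [Nonempty V] {ℓ m K : ℕ} (hℓ : 3 ≤ ℓ)
    (hm : 1 ≤ m) {G : UniformHypergraph V ℓ} (hG : G.IsDisperse)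
    (hK : ∀ L : Finset V, (#L < 2 * m + ℓ ∨
      (∀ R ⊆ L, #R = ℓ - 1 → HasSmallDegree (fun e => e ∈ G.edges) m L R) ∨
      (∀ R ⊆ L, #R = ℓ - 1 → HasSmallDegree (fun e => ¬ e ∈ G.edges) m L R)) → #L ≤ K) :
    ∃ b : ℕ, m * b ≤ (2 ^ ℓ + ℓ) * (Fintype.card V + m) * (Fintype.card V).choose (ℓ - 1) ∧
      ∀ p : ℝ, 0 ≤ p → p ≤ 1 →
        p * Fintype.card V - p ^ ℓ * b - p ^ 2 * (K * Fintype.card V) ≤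
          ((max G.independenceNumber G.cliqueNumber : ℕ) : ℝ) ^ 2 := by
  obtain ⟨H, B, Q, hH⟩ := hG.dispersePred.exists_isApproximation (m := m) (k := 2)
    (β := fun x => K * x) hℓ hm (fun x y => (mul_add _ _ _).ge) (by
      intro L hL hh
      -- The approximation inside a piece is irrelevant: every pair of the piece is listed in `Q`,
      -- so the set obtained by deletion contains no two vertices of the same piece.
      refine ⟨const ℓ L False, powersetCard 2 L, ?_, by simp, by simp, ?_, ?_, ?_⟩
      · exact isCohypergraphOn_of_forall L hL fun _ he hec => mem_const_edges he hec
      · exact fun q hq => (mem_powersetCard.1 hq).2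
      · rw [card_powersetCard, Nat.choose_two_right]
        refine (Nat.div_le_self _ _).trans ?_
        rw [mul_comm]
        exact Nat.mul_le_mul_right _ ((Nat.sub_le _ _).trans (hK L hh))
      · intro e he hec _
        obtain ⟨q, hq, hqc⟩ := exists_subset_card_eq (s := e) (n := 2) (by omega)
        exact Or.inr ⟨q, mem_powersetCard.2 ⟨hq.trans he, hqc⟩, hq⟩) univ univ_nonempty
  refine ⟨#B, by simpa using hH.card_bad_le, fun p hp0 hp1 => ?_⟩
  obtain ⟨Z, hZ, hZc⟩ := exists_independent_of_deletion hp0 hp1 (B ∪ Q) (by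
    intro e he
    rw [← card_pos]
    rcases mem_union.1 he with k | k
    · rw [hH.card_eq_of_mem_bad e k]; omega
    · rw [hH.card_eq_of_mem e k]; omega)
  have hagree : ∀ e ⊆ Z, #e = ℓ → (e ∈ H.edges ↔ e ∈ G.edges) := by
    intro e he hec
    by_contra hne
    rcases hH.mem_or_exists e (subset_univ e) hec hne with k | ⟨q, hq, hqe⟩
    · exact hZ e (mem_union_left _ k) he
    · exact hZ q (mem_union_right _ hq) (hqe.trans he)
  obtain ⟨C, hC, I, hI, hcC, hiI, hcard⟩ :=
    hH.isCohypergraphOn.exists_clique_independent (by omega) Z (subset_univ Z)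
  have hC' : G.IsClique C := fun e he hec => (hagree e (he.trans hC) hec).1 (hcC e he hec)
  have hI' : G.IsIndependent I := fun e he heG =>
    hiI e he ((hagree e (he.trans hI) (G.card_of_mem e heG)).2 heG)
  have hZs : #Z ≤ max G.independenceNumber G.cliqueNumber ^ 2 := by
    rw [sq]
    exact hcard.trans (Nat.mul_le_mul (hC'.card_le.trans (le_max_right _ _))
      (hI'.card_le.trans (le_max_left _ _)))
  have hZs' : (#Z : ℝ) ≤ ((max G.independenceNumber G.cliqueNumber : ℕ) : ℝ) ^ 2 := by
    exact_mod_cast hZs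
  have hsB : ∑ e ∈ B, p ^ #e = p ^ ℓ * #B := by
    rw [sum_congr rfl fun e he => by rw [hH.card_eq_of_mem_bad e he], sum_const, nsmul_eq_mul,
      mul_comm]
  have hsQ : ∑ e ∈ Q, p ^ #e ≤ p ^ 2 * (K * Fintype.card V) := by
    rw [sum_congr rfl fun e he => by rw [hH.card_eq_of_mem e he], sum_const, nsmul_eq_mul,
      mul_comm]
    have : (#Q : ℝ) ≤ K * Fintype.card V := by
      have := hH.card_le
      rw [card_univ] at this
      exact_mod_cast this
    exact mul_le_mul_of_nonneg_left this (by positivity)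
  have hsum : ∑ e ∈ B ∪ Q, p ^ #e ≤ ∑ e ∈ B, p ^ #e + ∑ e ∈ Q, p ^ #e := by
    rw [← sum_union_inter]
    exact le_add_of_nonneg_right (sum_nonneg fun _ _ => by positivity)
  linarith

theorem card_le_of_smallDegree [Fintype V] {ℓ m : ℕ} (hℓ : 1 ≤ ℓ) {G : UniformHypergraph V ℓ}
    {L : Finset V}
    (h : (∀ R ⊆ L, #R = ℓ - 1 → HasSmallDegree (fun e => e ∈ G.edges) m L R) ∨
      (∀ R ⊆ L, #R = ℓ - 1 → HasSmallDegree (fun e => ¬ e ∈ G.edges) m L R)) :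
    #L ≤ max G.independenceNumber G.cliqueNumber +
      max G.independenceNumber G.cliqueNumber ^ (ℓ - 1) * m := by
  have aux : ∀ I : Finset V, #I ≤ max G.independenceNumber G.cliqueNumber →
      #L ≤ #I + #I ^ (ℓ - 1) * m → #L ≤ max G.independenceNumber G.cliqueNumber +
      max G.independenceNumber G.cliqueNumber ^ (ℓ - 1) * m := fun I hI hL =>
    hL.trans (add_le_add hI (Nat.mul_le_mul_right _ (Nat.pow_le_pow_left hI _)))
  rcases h with h | h
  · obtain ⟨I, -, hI, hL⟩ := exists_independent_of_smallDegree hℓ h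
    have hI' : G.IsIndependent I := fun e he heG => hI e he (G.card_of_mem e heG) heG
    exact aux I (hI'.card_le.trans (le_max_left _ _)) hL
  · obtain ⟨C, -, hC, hL⟩ := exists_independent_of_smallDegree hℓ h
    have hC' : G.IsClique C := fun e he hec => not_not.1 (hC e he hec)
    exact aux C (hC'.card_le.trans (le_max_right _ _)) hL

/-- The Erdős–Hajnal property of disperse hypergraphs. -/
theorem IsDisperse.le_max_independenceNumber_cliqueNumber [Fintype V] {ℓ : ℕ} (hℓ : 3 ≤ ℓ)
    {G : UniformHypergraph V ℓ} (hG : G.IsDisperse) :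
    1 / 6 * (Fintype.card V : ℝ) ^ (1 / (3 * (ℓ : ℝ) - 1)) ≤
      ((max G.independenceNumber G.cliqueNumber : ℕ) : ℝ) := by
  have hℓr : (3 : ℝ) ≤ ℓ := by exact_mod_cast hℓ
  rcases isEmpty_or_nonempty V with hV | hV
  · rw [Fintype.card_eq_zero, Nat.cast_zero, Real.zero_rpow (by
      have : (0 : ℝ) < 3 * ℓ - 1 := by linarith
      positivity)]
    simp
  set n := Fintype.card V with hn
  have hn1 : 1 ≤ n := Fintype.card_pos
  have hn1' : (1 : ℝ) ≤ n := by exact_mod_cast hn1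
  set t : ℝ := (n : ℝ) ^ (1 / (3 * (ℓ : ℝ) - 1)) with ht
  set s := max G.independenceNumber G.cliqueNumber with hs
  have ht1 : 1 ≤ t := Real.one_le_rpow hn1' (by
    have : (0 : ℝ) < 3 * ℓ - 1 := by linarith
    positivity)
  obtain ⟨j, rfl⟩ : ∃ j, ℓ = j + 1 := ⟨ℓ - 1, by omega⟩
  have htn : t ^ (3 * j + 2) = n := by
    rw [ht, ← Real.rpow_natCast, ← Real.rpow_mul (by positivity)]
    push_cast
    rw [show 1 / (3 * ((j : ℝ) + 1) - 1) * (3 * j + 2) = 1 by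
      rw [show 3 * ((j : ℝ) + 1) - 1 = 3 * j + 2 by ring]
      exact one_div_mul_cancel (by positivity), Real.rpow_one]
  by_contra! hlt
  have hst : (s : ℝ) < t / 6 := by linarith
  -- Sets with fewer than `ℓ = j + 1` vertices are independent. With `s < t / 6` this forces `t > 6
  -- * j ≥ 12`, so no separate treatment of small `n` is needed.
  have hmin : min n j ≤ s := by
    obtain ⟨I, -, hIc⟩ := exists_subset_card_eq (s := (univ : Finset V)) (n := min n j)
      (by rw [card_univ]; exact min_le_left _ _)
    have hI : G.IsIndependent I := by
      intro e he heG
      have h1 := card_le_card he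
      rw [G.card_of_mem e heG, hIc] at h1
      have := min_le_right n j
      omega
    rw [← hIc]
    exact hI.card_le.trans (le_max_left _ _)
  have htn' : t ≤ n := by
    rw [← htn]; exact le_self_pow₀ ht1 (by omega)
  have hjs : (j : ℝ) ≤ s := by
    rcases min_le_iff.1 hmin with k | k
    · have : (n : ℝ) ≤ s := by exact_mod_cast k
      linarith
    · exact_mod_cast k
  have hj2 : (2 : ℝ) ≤ j := by
    have : 2 ≤ j := by omega
    exact_mod_cast this
  have ht12 : 12 < t := by linarith
  -- In this scale `n = a ^ 3 * t ^ 2`. With `m` about `a ^ 2`, a piece of small degree has size at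
  -- most about `s ^ j * m`, hence at most `a ^ 3`, the value behind `K`.
  set a : ℝ := t ^ j with ha
  have hat : t ^ 2 ≤ a := pow_le_pow_right₀ ht1 (by omega)
  have ha12 : 144 ≤ a := by nlinarith
  have hna : (n : ℝ) = a ^ 3 * t ^ 2 := by rw [← htn, ha]; ring
  set m := ⌈a ^ 2⌉₊ with hm
  have hm1 : a ^ 2 ≤ m := Nat.le_ceil _
  have hm2 : (m : ℝ) < a ^ 2 + 1 := Nat.ceil_lt_add_one (by positivity)
  set K := ⌊a ^ 3⌋₊ with hK
  have hK1 : (K : ℝ) ≤ a ^ 3 := Nat.floor_le (by positivity)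
  have haa : 1 ≤ a ^ 2 := one_le_pow₀ (by linarith)
  have ha3 : 144 * a ^ 2 ≤ a ^ 3 := by nlinarith
  have hta : t ≤ a ^ 2 := by nlinarith
  have hpiece : ∀ L : Finset V, (#L < 2 * m + (j + 1) ∨
      (∀ R ⊆ L, #R = (j + 1) - 1 → HasSmallDegree (fun e => e ∈ G.edges) m L R) ∨
      (∀ R ⊆ L, #R = (j + 1) - 1 → HasSmallDegree (fun e => ¬ e ∈ G.edges) m L R)) → #L ≤ K := by
    intro L hL
    rw [hK]
    refine Nat.le_floor ?_
    rcases hL with hL | hL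
    · have hL' : (#L : ℝ) < 2 * m + (j + 1) := by exact_mod_cast hL
      linarith
    · have h1 := card_le_of_smallDegree (by omega) hL
      rw [← hs, Nat.add_sub_cancel] at h1
      have h2 : (#L : ℝ) ≤ s + s ^ j * m := by exact_mod_cast h1
      have h3 : (s : ℝ) ^ j ≤ a / 36 := by
        calc (s : ℝ) ^ j ≤ (t / 6) ^ j := pow_le_pow_left₀ (by positivity) hst.le _
          _ = a / 6 ^ j := by rw [div_pow]
          _ ≤ a / 6 ^ 2 := by
            refine div_le_div_of_nonneg_left (by linarith) (by norm_num) ?_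
            exact pow_le_pow_right₀ (by norm_num) (by omega)
          _ = a / 36 := by norm_num
      have h4 : (s : ℝ) ^ j * m ≤ a / 36 * (2 * a ^ 2) :=
        mul_le_mul h3 (by linarith) (by positivity) (by positivity)
      have h5 : a / 36 * (2 * a ^ 2) = a ^ 3 / 18 := by ring
      have h6 : 0 ≤ a ^ 3 := by positivity
      linarith
  have hm0 : 1 ≤ m := by
    have : (0 : ℝ) < m := by linarith
    exact_mod_cast this
  obtain ⟨b, hb, hfin⟩ := hG.le_sq_of_forall_piece_le hℓ hm0 hpiece
  rw [← hn] at hb hfin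
  have ha0 : 0 < a := by linarith
  have ht0 : 0 < t := by linarith
  -- Of order `1 / K`, so that the expected number of pairs inside pieces is at most an eighth of `p
  -- * n = t ^ 2 / 8`.
  set p : ℝ := 1 / (8 * a ^ 3) with hp
  have hp0 : 0 ≤ p := by positivity
  have hp1 : p ≤ 1 := by
    rw [hp, div_le_one (by positivity)]
    linarith
  have hpn : p * n = t ^ 2 / 8 := by
    rw [hna, hp]; field_simp
  have hfin' := hfin p hp0 hp1
  have hQ : p ^ 2 * (K * n) ≤ p * n / 8 := by
    have h1 : p * K ≤ 1 / 8 := by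
      calc p * K ≤ p * a ^ 3 := mul_le_mul_of_nonneg_left hK1 hp0
        _ = 1 / 8 := by rw [hp]; field_simp
    calc p ^ 2 * (K * n) = p * K * (p * n) := by ring
      _ ≤ 1 / 8 * (p * n) := mul_le_mul_of_nonneg_right h1 (by positivity)
      _ = p * n / 8 := by ring
  have hB : p ^ (j + 1) * b ≤ p * n / 2 := by
    have hmn : (m : ℝ) ≤ n := by
      rw [hna]
      nlinarith [show 0 ≤ a ^ 3 by positivity, show (1 : ℝ) ≤ t ^ 2 from one_le_pow₀ ht1]
    have hbr : (m : ℝ) * b ≤ (2 ^ (j + 1) + (j + 1)) * (n + m) * (n.choose j : ℕ) := by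
      rw [Nat.add_sub_cancel] at hb
      exact_mod_cast hb
    have hc : (2 : ℝ) ^ (j + 1) + (j + 1) ≤ 4 * 2 ^ j := by
      have : j + 1 ≤ 2 ^ j := Nat.lt_two_pow_self
      have : (j : ℝ) + 1 ≤ 2 ^ j := by exact_mod_cast this
      rw [pow_succ]
      have : (0 : ℝ) ≤ 2 ^ j := by positivity
      linarith
    have hch : ((n.choose j : ℕ) : ℝ) ≤ n ^ j := by exact_mod_cast Nat.choose_le_pow n j
    have h1 : a ^ 2 * b ≤ 4 * 2 ^ j * (2 * n) * n ^ j := by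
      calc a ^ 2 * b ≤ m * b := mul_le_mul_of_nonneg_right hm1 (by positivity)
        _ ≤ _ := hbr
        _ ≤ 4 * 2 ^ j * (2 * n) * n ^ j := by
          refine mul_le_mul (mul_le_mul hc (by linarith) (by positivity) (by positivity)) hch
            (by positivity) (by positivity)
    -- The factor `a ^ 2` here matches the `m` in the bound on `b`; this is what fixes the exponent
    -- `3 * ℓ - 1`.
    have h2 : (p * n) ^ j = a ^ 2 / 8 ^ j := by
      rw [hpn, div_pow, ha]; ring
    have h3 : (2 : ℝ) ^ j / 8 ^ j ≤ 1 / 16 := by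
      rw [← div_pow]
      calc ((2 : ℝ) / 8) ^ j ≤ (2 / 8) ^ 2 :=
            pow_le_pow_of_le_one (by norm_num) (by norm_num) (by omega)
        _ = 1 / 16 := by norm_num
    have h4 : a ^ 2 * (p ^ (j + 1) * b) ≤ a ^ 2 * (p * n / 2) := by
      calc a ^ 2 * (p ^ (j + 1) * b) = p ^ (j + 1) * (a ^ 2 * b) := by ring
        _ ≤ p ^ (j + 1) * (4 * 2 ^ j * (2 * n) * n ^ j) :=
            mul_le_mul_of_nonneg_left h1 (by positivity)
        _ = 8 * 2 ^ j * (p * n) * (p * n) ^ j := by rw [mul_pow]; ring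
        _ = 8 * (p * n) * a ^ 2 * (2 ^ j / 8 ^ j) := by rw [h2]; ring
        _ ≤ 8 * (p * n) * a ^ 2 * (1 / 16) := mul_le_mul_of_nonneg_left h3 (by positivity)
        _ = _ := by ring
    exact le_of_mul_le_mul_left h4 (by positivity)
  have hs2 : (s : ℝ) ^ 2 < (t / 6) ^ 2 := pow_lt_pow_left₀ hst (by positivity) (by norm_num)
  have ht2 : 0 < t ^ 2 := by positivity
  have h36 : (t / 6) ^ 2 = t ^ 2 / 36 := by ring
  -- The surviving set has size at least `(1 - 1 / 2 - 1 / 8) * t ^ 2 / 8 = 3 * t ^ 2 / 64`, which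
  -- exceeds `t ^ 2 / 36`.
  linarith

end UniformHypergraph

end Main

theorem mainTheorem1 :
    (∃ c : ℝ, 0 < c ∧
      ∀ ℓ : ℕ, 3 ≤ ℓ →
        ∀ (V : Type*) [Fintype V] [DecidableEq V] (G : UniformHypergraph V ℓ), G.IsDisperse →
          c * (Fintype.card V : ℝ) ^ (1 / (3 * (ℓ : ℝ) - 1)) ≤
            ((max G.independenceNumber G.cliqueNumber : ℕ) : ℝ)) ∧
    (∀ ℓ : ℕ, 3 ≤ ℓ →
      ∃ C : ℝ, 0 < C ∧
        ∀ (V : Type*) [Fintype V] [DecidableEq V] [Nonempty V] (G : UniformHypergraph V ℓ),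
          G.IsDisperse →
            ∃ H : UniformHypergraph V ℓ, H.IsCohypergraph ∧
              (#(G.edges ∆ H.edges) : ℝ) ≤ C * (Fintype.card V : ℝ) ^ ((ℓ : ℝ) - 1 / 2)) := by
  refine ⟨⟨1 / 6, by norm_num, fun ℓ hℓ V _ _ G hG =>
    hG.le_max_independenceNumber_cliqueNumber hℓ⟩, fun ℓ hℓ => ?_⟩
  exact ⟨3 * (2 ^ ℓ + ℓ) + (4 + ℓ), by positivity, fun V _ _ _ G hG =>
    hG.exists_isCohypergraph hℓ⟩
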